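/- For $f:\mathbb R\to\mathbb R$ with $\int_{\mathbb R}\frac{|f(t)|}{1+t^2}\,dt<\infty$ let the modified Hilbert transform be the almost everywhere defined function $$\mathcal H(f)(x)=\frac1\pi\,\mathrm{p.v.}\!\int_{\mathbb R} f(t)\left(\frac1{x-t}+\frac t{t^2+1}\right)dt =\frac1\pi\lim_{\varepsilon\to0+}\int_{|x-t|\ge\varepsilon} f(t)\left(\frac1{x-t}+\frac t{t^2+1}\right)dt ,$$ and let $\widehat f(\xi)=\int_{\mathbb R}e^{-2\pi i x\xi}f(x)\,dx$ be the Fourier transform, extended to $L^2(\mathbb R)$. Theorem (effective multiplier theorem). Let $0<\sigma<\frac1{10}$ and let $\omega:\mathbb R\to(0,1]$ be measurable with $$\int_{\mathbb R}\frac{\log\omega(x)}{1+x^2}\,dx>-\infty .$$ Put $\Omega=-\log\omega$, and assume that $\mathcal H(\Omega)$ has a weak derivative satisfying $$\|(\mathcal H(\Omega))'\|_{L^\infty(\mathbb R)}\le\frac\pi2\,\sigma .$$ Then there is $\psi\in L^2(\mathbb R)$ such that $\operatorname{supp}\psi\subset[0,\sigma]$, $|\widehat\psi|\le\omega$ almost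 everywhere on $\mathbb R$, and $$\|\widehat\psi\|_{L^2[-1,1]}\ \ge\ \frac{\sigma^6}{600000}\,\min\bigl(\|\omega\|_{L^2(1/2,1)},\ \|\omega\|_{L^2(-1,-1/2)}\bigr).$$ -/

import Mathlib

open MeasureTheory Filter Topology
open scoped FourierTransform ENNReal

noncomputable section

/-- The truncation at level `ε` of the modified Hilbert transform of `f` at `x`:
`(1/π) ∫_{|x - t| ≥ ε} f(t) (1/(x-t) + t/(t²+1)) dt`. -/
def truncModifiedHilbert (f : ℝ → ℝ) (ε x : ℝ) : ℝ :=
  (1 / Real.pi) * ∫ t in {t : ℝ | ε ≤ |x - t|}, f t * (1 / (x - t) + t / (t ^ 2 + 1))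

/-- `h` is (a representative of) the modified Hilbert transform of `f`, that is,
`h(x) = (1/π) p.v.∫ f(t) (1/(x-t) + t/(t²+1)) dt` for almost every `x`. -/
def IsModifiedHilbertTransform (f h : ℝ → ℝ) : Prop :=
  ∀ᵐ x : ℝ, Tendsto (fun ε : ℝ => truncModifiedHilbert f ε x) (𝓝[>] 0) (𝓝 (h x))

/-- `u` is the weak (distributional) derivative of `h` on the real line. -/
def HasWeakDeriv (h u : ℝ → ℝ) : Prop :=
  LocallyIntegrable h ∧ LocallyIntegrable u ∧
    ∀ φ : ℝ → ℝ, ContDiff ℝ (⊤ : ℕ∞) φ → HasCompactSupport φ →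
      ∫ x, h x * deriv φ x = -∫ x, u x * φ x

end

/-! The function `ψ` comes from a function `F` analytic in the upper half plane. The outer function
exp(-A), where A has boundary values Ω + i·H(Ω), has modulus ω on the line. It remains to give the
boundary value a spectrum in [0, σ] without destroying its size. If `F` has quadratic decay, its
boundary value F₀ has no negative frequencies. If moreover exp(-iπσx)·F₀(x) is real up to a constant
factor, reflection gives no frequencies above σ (`exists_fourier_eq_conj`). So everything reduces to
correcting a phase modulo π.

The outer function has phase -H(Ω). Multiply it by exp(i(S + i·H(S))), whose phase is S, and by the
fourth power of the Laplace transform U of the uniform density on [0, σ/8], whose phase modulo π is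
πσx/2. Taking S = φ - πN with φ = πσx/2 + H(Ω) - c and N integer valued makes the total phase πσx -
c modulo π (`conj_multiplierBoundary`). N is chosen to reduce φ to [-π/2, π/2), so that S is
bounded.

The cost is the factor exp(-H(S)). The derivative bound on H(Ω) makes φ increasing with slope at
most πσ. Hence S jumps only downwards, each jump produces a zero and not a pole of exp(-H(S)), and
this factor grows at most quadratically in σ|z| (`norm_exp_sawtooth_le`). Two factors U absorb the
growth and the other two give the quadratic decay. Normalising φ(0) = 0 keeps the jumps away from
[-1, 1], where exp(-H(S)) is then bounded below (`le_norm_exp_sawtooth`). This gives |F₀| ≤ ω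
everywhere, and |F₀| at least an absolute constant times ω on [-1, 1], almost everywhere. -/

/-! ### Fourier inversion and Paley–Wiener -/

theorem integral_fourierInv_mul_eq {f g : ℝ → ℂ} (hf : Integrable f) (hg : Integrable g) :
    ∫ x, (𝓕⁻ f) x * g x = ∫ x, f x * (𝓕⁻ g) x := by
  have key := VectorFourier.integral_fourierIntegral_smul_eq_flip (𝕜 := ℝ) (V := ℝ) (W := ℝ)
    (e := Real.fourierChar) (μ := volume) (ν := volume) (L := -innerₗ ℝ) (f := f) (g := g)
    Real.continuous_fourierChar (by simp only [LinearMap.neg_apply]; fun_prop) hf hg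
  have hflip : (-innerₗ ℝ : ℝ →ₗ[ℝ] ℝ →ₗ[ℝ] ℝ).flip = -innerₗ ℝ := by
    ext; simp
  rw [hflip] at key
  exact key

/-- The `L²` inverse Fourier transform of an integrable function is given by the integral. -/
theorem fourierInv_toLp_ae_eq {K : ℝ → ℂ} (hK1 : Integrable K) (hK2 : MemLp K 2 volume) :
    (𝓕⁻ (hK2.toLp K) : Lp ℂ 2 (volume : Measure ℝ)) =ᵐ[volume] 𝓕⁻ K := by
  set ψ : Lp ℂ 2 (volume : Measure ℝ) := 𝓕⁻ (hK2.toLp K) with hψ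
  have hψl : LocallyIntegrable (ψ : ℝ → ℂ) := (Lp.memLp ψ).locallyIntegrable (by norm_num)
  have hcont : Continuous (𝓕⁻ K) := by
    have h1 : Continuous (𝓕 K) :=
      VectorFourier.fourierIntegral_continuous Real.continuous_fourierChar
        (by exact continuous_inner) hK1
    have : 𝓕⁻ K = fun x => 𝓕 K (-x) := by
      ext x; rw [Real.fourierInv_eq_fourier_neg]
    rw [this]; exact h1.comp continuous_neg
  -- Both functions are locally integrable, so it suffices to compare them as distributions. Against
  -- a test function, the `L²` transform and the integral transform can both be moved onto the test
  -- function.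
  have h0 : ∀ᵐ x, (ψ : ℝ → ℂ) x - (𝓕⁻ K) x = 0 := by
    apply ae_eq_zero_of_integral_contDiff_smul_eq_zero (hψl.sub hcont.locallyIntegrable)
    intro g g_smooth g_cpt
    have hg₁ : HasCompactSupport (Complex.ofRealCLM ∘ g) := g_cpt.comp_left rfl
    have hg₂ : ContDiff ℝ (⊤ : ℕ∞) (Complex.ofRealCLM ∘ g) := by fun_prop
    set G := hg₁.toSchwartzMap hg₂ with hG
    have hGg : ∀ x, G x = (g x : ℂ) := fun x => by simp [hG]
    have e := congrArg (fun T => T G) (Lp.fourierInv_toTemperedDistribution_eq (hK2.toLp K))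
    simp only [TemperedDistribution.fourierInv_apply, Lp.toTemperedDistribution_apply] at e
    have e1 : ∫ x, (𝓕⁻ G) x • (hK2.toLp K) x = ∫ x, K x * (𝓕⁻ (G : ℝ → ℂ)) x := by
      apply integral_congr_ae
      filter_upwards [hK2.coeFn_toLp] with x hx
      rw [hx, SchwartzMap.fourierInv_coe, smul_eq_mul, mul_comm]
    have e2 := integral_fourierInv_mul_eq hK1 (G.integrable (μ := volume))
    rw [e1, ← e2] at e
    have i1 : Integrable fun x => g x • (ψ : ℝ → ℂ) x :=
      hψl.integrable_smul_left_of_hasCompactSupport g_smooth.continuous g_cpt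
    have i2 : Integrable fun x => g x • (𝓕⁻ K) x :=
      hcont.locallyIntegrable.integrable_smul_left_of_hasCompactSupport g_smooth.continuous g_cpt
    simp only [Pi.sub_apply, smul_sub]
    rw [integral_sub i1 i2, sub_eq_zero]
    simp only [hGg, smul_eq_mul] at e
    simp only [Complex.real_smul]
    rw [← e]
    simp only [mul_comm]
  filter_upwards [h0] with x hx using sub_eq_zero.mp hx

theorem norm_le_div_one_add_sq_of_re {C : ℝ} (hC : 0 ≤ C) (x y : ℝ) :
    C / (1 + ‖(x + y * Complex.I : ℂ)‖ ^ 2) ≤ C * (1 + x ^ 2)⁻¹ := by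
  rw [div_eq_mul_inv]
  have : ‖(x + y * Complex.I : ℂ)‖ ^ 2 = x ^ 2 + y ^ 2 := by
    rw [← Complex.normSq_eq_norm_sq, Complex.normSq_add_mul_I]
  rw [this]
  gcongr
  nlinarith [sq_nonneg y]

theorem continuous_horizontal {g : ℂ → ℂ} (hg : DifferentiableOn ℂ g {z | 0 < z.im}) {y : ℝ}
    (hy : 0 < y) : Continuous fun x : ℝ => g (x + y * Complex.I) := by
  apply hg.continuousOn.comp_continuous (by fun_prop)
  intro x; simpa using hy

/-- Contour shift: horizontal integrals of a function with quadratic decay on the upper half plane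
do not depend on the height. -/
theorem integral_horizontal_eq {g : ℂ → ℂ} {C : ℝ} (hg : DifferentiableOn ℂ g {z | 0 < z.im})
    (hb : ∀ z : ℂ, 0 < z.im → ‖g z‖ ≤ C / (1 + ‖z‖ ^ 2)) (hC : 0 ≤ C) {y₁ y₂ : ℝ} (h1 : 0 < y₁)
    (h12 : y₁ ≤ y₂) :
    ∫ x : ℝ, g (x + y₁ * Complex.I) = ∫ x : ℝ, g (x + y₂ * Complex.I) := by
  have hbx : ∀ x y : ℝ, 0 < y → ‖g (x + y * Complex.I)‖ ≤ C * (1 + x ^ 2)⁻¹ := fun x y hy =>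
    (hb _ (by simpa using hy)).trans (norm_le_div_one_add_sq_of_re hC x y)
  have hint : ∀ y : ℝ, 0 < y → Integrable fun x : ℝ => g (x + y * Complex.I) := fun y hy =>
    (integrable_inv_one_add_sq.const_mul C).mono'
      (continuous_horizontal hg hy).aestronglyMeasurable (ae_of_all _ fun x => hbx x y hy)
  have hlim : ∀ y : ℝ, 0 < y → Tendsto (fun R : ℝ => ∫ x in (-R)..R, g (x + y * Complex.I)) atTop
      (𝓝 (∫ x : ℝ, g (x + y * Complex.I))) := fun y hy =>
    intervalIntegral_tendsto_integral (hint y hy) tendsto_neg_atTop_atBot tendsto_id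
  have h2 : 0 < y₂ := h1.trans_le h12
  -- The vertical sides have fixed length and an integrand of size O(R⁻²); `s` stands for either of
  -- the abscissae R and -R.
  have hside : ∀ s : ℝ → ℝ, (∀ R, (s R) ^ 2 = R ^ 2) →
      Tendsto (fun R : ℝ => ∫ y in y₁..y₂, g (s R + y * Complex.I)) atTop (𝓝 0) := by
    intro s hs
    apply squeeze_zero_norm (a := fun R : ℝ => (C * (1 + R ^ 2)⁻¹) * |y₂ - y₁|)
    · intro R
      apply intervalIntegral.norm_integral_le_of_norm_le_const
      intro y hy
      rw [Set.uIoc_of_le h12] at hy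
      have := hbx (s R) y (h1.trans hy.1)
      rwa [hs] at this
    · have : Tendsto (fun R : ℝ => (1 + R ^ 2)⁻¹) atTop (𝓝 0) :=
        tendsto_inv_atTop_zero.comp
          (tendsto_atTop_add_const_left _ _ (tendsto_pow_atTop two_ne_zero))
      simpa using (this.const_mul C).mul_const |y₂ - y₁|
  have hrect : ∀ R : ℝ, ((∫ x in (-R)..R, g (x + y₁ * Complex.I))
      - ∫ x in (-R)..R, g (x + y₂ * Complex.I))
      + Complex.I • (∫ y in y₁..y₂, g (R + y * Complex.I))
      - Complex.I • (∫ y in y₁..y₂, g ((-R : ℝ) + y * Complex.I)) = 0 := by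
    intro R
    have := Complex.integral_boundary_rect_eq_zero_of_differentiableOn g ⟨-R, y₁⟩ ⟨R, y₂⟩ ?_
    · simpa using this
    · apply hg.mono
      intro z hz
      have := hz.2
      simp only [Set.mem_preimage, Set.uIcc_of_le h12] at this
      exact h1.trans_le this.1
  have hL := (((hlim y₁ h1).sub (hlim y₂ h2)).add
    ((hside id fun R => rfl).const_smul Complex.I)).sub
    ((hside (fun R => -R) fun R => by ring).const_smul Complex.I)
  have h0 := tendsto_nhds_unique hL (by
    refine tendsto_const_nhds.congr fun R => ?_
    exact (hrect R).symm)
  simpa [sub_eq_zero] using h0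

/-- **Paley–Wiener**, one half: the boundary value of a function analytic in the upper half plane
with quadratic decay has vanishing Fourier transform on the negative half line. -/
theorem fourier_eq_zero_of_neg {F : ℂ → ℂ} {C : ℝ} (hF : DifferentiableOn ℂ F {z | 0 < z.im})
    (hb : ∀ z : ℂ, 0 < z.im → ‖F z‖ ≤ C / (1 + ‖z‖ ^ 2)) {F₀ : ℝ → ℂ}
    (hlim : ∀ᵐ x : ℝ, Tendsto (fun y : ℝ => F (x + y * Complex.I)) (𝓝[>] 0) (𝓝 (F₀ x)))
    {ξ : ℝ} (hξ : ξ < 0) : 𝓕 F₀ ξ = 0 := by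
  have hC : 0 ≤ C := by
    have := (norm_nonneg _).trans (hb Complex.I (by simp))
    simp at this
    linarith
  set e : ℂ → ℂ := fun z => Complex.exp (-2 * Real.pi * ξ * Complex.I * z) with he
  have hen : ∀ x y : ℝ, ‖e (x + y * Complex.I)‖ = Real.exp (2 * Real.pi * ξ * y) := by
    intro x y
    simp only [he, Complex.norm_exp]
    congr 1
    simp
  set g : ℂ → ℂ := fun z => e z * F z with hgdef
  have hg : DifferentiableOn ℂ g {z | 0 < z.im} :=
    DifferentiableOn.mul (by simp only [he]; fun_prop) hF
  have hz : ∀ z : ℂ, z = z.re + z.im * Complex.I := fun z => (Complex.re_add_im z).symm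
  have hgb' : ∀ x y : ℝ, 0 < y → ‖g (x + y * Complex.I)‖
      ≤ Real.exp (2 * Real.pi * ξ * y) * (C * (1 + x ^ 2)⁻¹) := by
    intro x y hy
    simp only [hgdef, norm_mul, hen]
    gcongr
    exact (hb _ (by simpa using hy)).trans (norm_le_div_one_add_sq_of_re hC x y)
  have hexp1 : ∀ y : ℝ, 0 < y → Real.exp (2 * Real.pi * ξ * y) ≤ 1 := by
    intro y hy
    rw [Real.exp_le_one_iff]
    have := Real.pi_pos
    nlinarith [mul_pos this hy]
  have hgb : ∀ z : ℂ, 0 < z.im → ‖g z‖ ≤ C / (1 + ‖z‖ ^ 2) := by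
    intro z hz0
    simp only [hgdef, norm_mul]
    have h1 : ‖e z‖ ≤ 1 := by
      rw [hz z, hen]; exact hexp1 _ hz0
    calc ‖e z‖ * ‖F z‖ ≤ 1 * ‖F z‖ := by gcongr
      _ ≤ _ := by rw [one_mul]; exact hb z hz0
  -- For ξ < 0 the exponential contributes exp(2πξY) at height Y, so raising the contour to infinity
  -- makes the integral vanish. Dominated convergence then brings the contour down to the real line.
  have hJ : ∀ y : ℝ, 0 < y → ∫ x : ℝ, g (x + y * Complex.I) = 0 := by
    intro y hy
    have hle : ∀ᶠ Y : ℝ in atTop, ‖∫ x : ℝ, g (x + y * Complex.I)‖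
        ≤ Real.exp (2 * Real.pi * ξ * Y) * ∫ x : ℝ, C * (1 + x ^ 2)⁻¹ := by
      filter_upwards [eventually_ge_atTop y] with Y hY
      rw [integral_horizontal_eq hg hgb hC hy hY, ← integral_const_mul]
      exact norm_integral_le_of_norm_le ((integrable_inv_one_add_sq.const_mul C).const_mul _)
        (ae_of_all _ fun x => hgb' x Y (hy.trans_le hY))
    have ht : Tendsto (fun Y : ℝ => Real.exp (2 * Real.pi * ξ * Y) * ∫ x : ℝ, C * (1 + x ^ 2)⁻¹)
        atTop (𝓝 0) := by
      have h1 : Tendsto (fun Y : ℝ => 2 * Real.pi * ξ * Y) atTop atBot :=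
        tendsto_id.const_mul_atTop_of_neg (by have := Real.pi_pos; nlinarith)
      simpa using (Real.tendsto_exp_atBot.comp h1).mul_const (∫ x : ℝ, C * (1 + x ^ 2)⁻¹)
    exact norm_le_zero_iff.mp (ge_of_tendsto ht hle)
  have hdct : Tendsto (fun y : ℝ => ∫ x : ℝ, g (x + y * Complex.I)) (𝓝[>] 0)
      (𝓝 (∫ x : ℝ, e x * F₀ x)) := by
    apply tendsto_integral_filter_of_dominated_convergence (fun x => C * (1 + x ^ 2)⁻¹)
    · filter_upwards [self_mem_nhdsWithin] with y hy
      exact (continuous_horizontal hg hy).aestronglyMeasurable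
    · filter_upwards [self_mem_nhdsWithin] with y hy
      exact ae_of_all _ fun x => (hgb _ (by simpa using hy)).trans
        (norm_le_div_one_add_sq_of_re hC x y)
    · exact integrable_inv_one_add_sq.const_mul C
    · filter_upwards [hlim] with x hx
      refine Tendsto.mul ?_ hx
      have : Tendsto (fun y : ℝ => e (x + y * Complex.I)) (𝓝 0) (𝓝 (e (x + (0 : ℝ) * Complex.I))) :=
        Continuous.tendsto (by simp only [he]; fun_prop) 0
      simp only [Complex.ofReal_zero, zero_mul, add_zero] at this
      exact this.mono_left nhdsWithin_le_nhds
  have h0 : ∫ x : ℝ, e x * F₀ x = 0 := by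
    refine tendsto_nhds_unique hdct (tendsto_const_nhds.congr' ?_)
    filter_upwards [self_mem_nhdsWithin] with y hy using (hJ y hy).symm
  rw [Real.fourier_real_eq_integral_exp_smul, ← h0]
  congr 1; ext x
  simp only [he, smul_eq_mul]
  congr 2; push_cast; ring

/-- **Paley–Wiener** for a function `F` on the upper half plane with boundary value `F₀` such that
`exp(-iπσx) F₀(x)` is real up to a constant factor: `conj F₀` is the Fourier transform of an `L²`
function supported on `[0, σ]`. -/
theorem exists_fourier_eq_conj {F : ℂ → ℂ} {C σ : ℝ} {c : ℂ}
    (hF : DifferentiableOn ℂ F {z | 0 < z.im})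
    (hb : ∀ z : ℂ, 0 < z.im → ‖F z‖ ≤ C / (1 + ‖z‖ ^ 2)) {F₀ : ℝ → ℂ}
    (hlim : ∀ᵐ x : ℝ, Tendsto (fun y : ℝ => F (x + y * Complex.I)) (𝓝[>] 0) (𝓝 (F₀ x)))
    (hsymm : ∀ᵐ x : ℝ, (starRingEnd ℂ) (F₀ x)
      = c * Complex.exp (-(2 * Real.pi * σ * x) * Complex.I) * F₀ x) :
    ∃ ψ : Lp ℂ 2 (volume : Measure ℝ),
      (∀ᵐ x : ℝ, x ∉ Set.Icc (0 : ℝ) σ → ψ x = 0) ∧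
      (𝓕 ψ : Lp ℂ 2 (volume : Measure ℝ)) =ᵐ[volume] fun x => (starRingEnd ℂ) (F₀ x) := by
  have hC : 0 ≤ C := by
    have := (norm_nonneg _).trans (hb Complex.I (by simp))
    simp at this
    linarith
  have hneg : ∀ ξ < 0, 𝓕 F₀ ξ = 0 := fun ξ hξ => fourier_eq_zero_of_neg hF hb hlim hξ
  have hF₀b : ∀ᵐ x : ℝ, ‖F₀ x‖ ≤ C * (1 + x ^ 2)⁻¹ := by
    filter_upwards [hlim] with x hx
    refine le_of_tendsto hx.norm ?_
    filter_upwards [self_mem_nhdsWithin] with y hy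
    exact (hb _ (by simpa using hy)).trans (norm_le_div_one_add_sq_of_re hC x y)
  have hseq : Tendsto (fun n : ℕ => 1 / ((n : ℝ) + 1)) atTop (𝓝[>] 0) :=
    tendsto_nhdsWithin_iff.mpr ⟨tendsto_one_div_add_atTop_nhds_zero_nat,
      Eventually.of_forall fun n =>
      Set.mem_Ioi.mpr Nat.one_div_pos_of_nat⟩
  have hF₀m : AEStronglyMeasurable F₀ := by
    refine aestronglyMeasurable_of_tendsto_ae atTop
      (f := fun (n : ℕ) (x : ℝ) => F (x + (1 / ((n : ℝ) + 1) : ℝ) * Complex.I)) ?_ ?_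
    · intro n
      exact (continuous_horizontal hF (by positivity)).aestronglyMeasurable
    · filter_upwards [hlim] with x hx using hx.comp hseq
  set K : ℝ → ℂ := fun x => (starRingEnd ℂ) (F₀ x) with hK
  have hKm : AEStronglyMeasurable K := Complex.continuous_conj.comp_aestronglyMeasurable hF₀m
  have hKb : ∀ᵐ x : ℝ, ‖K x‖ ≤ C * (1 + x ^ 2)⁻¹ := by
    filter_upwards [hF₀b] with x hx
    simpa [hK] using hx
  have hK1 : Integrable K := (integrable_inv_one_add_sq.const_mul C).mono' hKm hKb
  have hK2 : MemLp K 2 volume := by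
    rw [memLp_two_iff_integrable_sq_norm hKm]
    apply ((integrable_inv_one_add_sq.const_mul C).const_mul C).mono' (hKm.norm.pow 2)
    filter_upwards [hKb] with x hx
    have h1 : C * (1 + x ^ 2)⁻¹ ≤ C :=
      mul_le_of_le_one_right hC (inv_le_one_of_one_le₀ (by nlinarith [sq_nonneg x]))
    rw [Pi.pow_apply, Real.norm_of_nonneg (sq_nonneg ‖K x‖), sq]
    exact mul_le_mul (hx.trans h1) hx (norm_nonneg _) hC
  have hinv : ∀ ξ, 𝓕⁻ K ξ = (starRingEnd ℂ) (𝓕 F₀ ξ) := by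
    intro ξ
    rw [Real.fourierInv_eq', Real.fourier_real_eq_integral_exp_smul, ← integral_conj]
    congr 1; ext x
    simp only [smul_eq_mul, map_mul, ← Complex.exp_conj, hK]
    congr 2
    simp [Complex.conj_ofNat]
    ring
  -- The symmetry of F₀ turns the frequency ξ into σ - ξ, so frequencies above σ reduce to negative
  -- ones.
  have hpos : ∀ ξ, σ < ξ → 𝓕⁻ K ξ = 0 := by
    intro ξ hξ
    have h1 : 𝓕⁻ K ξ = c * 𝓕 F₀ (σ - ξ) := by
      rw [Real.fourierInv_eq', Real.fourier_real_eq_integral_exp_smul, ← integral_const_mul]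
      apply integral_congr_ae
      filter_upwards [hsymm] with x hx
      simp only [hK, hx, smul_eq_mul]
      rw [show c * (Complex.exp (↑(-2 * Real.pi * x * (σ - ξ)) * Complex.I) * F₀ x)
        = c * Complex.exp (↑(-2 * Real.pi * x * (σ - ξ)) * Complex.I) * F₀ x by ring,
        ← mul_assoc, mul_left_comm, ← Complex.exp_add]
      congr 3
      simp
      ring
    rw [h1, hneg _ (by linarith), mul_zero]
  refine ⟨𝓕⁻ (hK2.toLp K), ?_, ?_⟩
  · filter_upwards [fourierInv_toLp_ae_eq hK1 hK2] with x hx hxs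
    rw [hx]
    rcases lt_or_ge x 0 with h | h
    · rw [hinv, hneg x h, map_zero]
    · exact hpos x (by by_contra hc; exact hxs ⟨h, not_lt.mp hc⟩)
  · rw [FourierTransform.fourier_fourierInv_eq]
    exact hK2.coeFn_toLp

/-! ### Weak derivatives and Lipschitz representatives -/

/-- du Bois-Reymond: a locally integrable function with vanishing weak derivative is constant. -/
theorem ae_eq_const_of_integral_mul_deriv_eq_zero {g : ℝ → ℝ} (hg : LocallyIntegrable g)
    (h : ∀ φ : ℝ → ℝ, ContDiff ℝ (⊤ : ℕ∞) φ → HasCompactSupport φ → ∫ x, g x * deriv φ x = 0) :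
    ∃ c : ℝ, ∀ᵐ x, g x = c := by
  obtain ⟨η, hηs, hηc, hη1⟩ : ∃ η : ℝ → ℝ, ContDiff ℝ (⊤ : ℕ∞) η ∧ HasCompactSupport η ∧
      ∫ x, η x = 1 := by
    let b : ContDiffBump (0 : ℝ) := ⟨1, 2, one_pos, one_lt_two⟩
    exact ⟨b.normed volume, b.contDiff_normed, b.hasCompactSupport_normed, b.integral_normed⟩
  refine ⟨∫ x, g x * η x, ?_⟩
  set c := ∫ x, g x * η x with hc
  have key : ∀ᵐ x, g x - c = 0 := by
    apply ae_eq_zero_of_integral_contDiff_smul_eq_zero (hg.sub (locallyIntegrable_const c))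
    intro φ hφs hφc
    set m := ∫ x, φ x with hm
    have hφi : Integrable φ := hφs.continuous.integrable_of_hasCompactSupport hφc
    have hηi : Integrable η := hηs.continuous.integrable_of_hasCompactSupport hηc
    -- Subtracting m·η gives mean zero, which is what makes the primitive `Φ` of `θ` compactly
    -- supported and hence an admissible test function.
    set θ : ℝ → ℝ := fun x => φ x - m * η x with hθ
    have hθs : ContDiff ℝ (⊤ : ℕ∞) θ := hφs.sub (contDiff_const.mul hηs)
    have hθc : HasCompactSupport θ := hφc.sub (hηc.mul_left)
    have hθi : Integrable θ := hθs.continuous.integrable_of_hasCompactSupport hθc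
    have hθ0 : ∫ x, θ x = 0 := by
      simp only [hθ]
      rw [integral_sub hφi (hηi.const_mul m), integral_const_mul, hη1]; ring
    obtain ⟨R, hR⟩ : ∃ R : ℝ, ∀ x, R < |x| → θ x = 0 := by
      obtain ⟨R, hR⟩ := hθc.isCompact.isBounded.subset_closedBall 0
      refine ⟨R, fun x hx => ?_⟩
      by_contra hne
      have := hR (subset_tsupport _ hne)
      simp at this
      linarith
    set Φ : ℝ → ℝ := fun x => ∫ t in Set.Iic x, θ t with hΦ
    have hΦd : ∀ x, HasDerivAt Φ (θ x) x := by
      intro x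
      have e : Φ = fun x => (∫ t in Set.Iic 0, θ t) + ∫ t in (0:ℝ)..x, θ t := by
        ext y
        have := intervalIntegral.integral_Iic_sub_Iic (μ := volume) (f := θ) (a := 0) (b := y)
          hθi.integrableOn hθi.integrableOn
        simp only [hΦ]; linarith
      rw [e]
      exact (intervalIntegral.integral_hasDerivAt_right (hθs.continuous.intervalIntegrable _ _)
        (hθs.continuous.stronglyMeasurableAtFilter _ _) hθs.continuous.continuousAt).const_add _
    have hΦderiv : deriv Φ = θ := funext fun x => (hΦd x).deriv
    have hΦs : ContDiff ℝ (⊤ : ℕ∞) Φ := by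
      rw [contDiff_infty_iff_deriv, hΦderiv]
      exact ⟨fun x => (hΦd x).differentiableAt, hθs⟩
    have hΦc : HasCompactSupport Φ := by
      apply HasCompactSupport.of_support_subset_isCompact (isCompact_Icc (a := -R) (b := R))
      intro x hx
      by_contra hxn
      apply hx
      simp only [Set.mem_Icc, not_and_or, not_le] at hxn
      rcases hxn with hx1 | hx1
      · simp only [hΦ]
        apply setIntegral_eq_zero_of_forall_eq_zero
        intro t ht
        apply hR
        simp only [Set.mem_Iic] at ht
        rw [lt_abs]; right; linarith
      · have h1 := integral_add_compl (measurableSet_Iic (a := x)) hθi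
        have h2 : ∫ t in (Set.Iic x)ᶜ, θ t = 0 := by
          apply setIntegral_eq_zero_of_forall_eq_zero
          intro t ht
          apply hR
          simp only [Set.mem_compl_iff, Set.mem_Iic, not_le] at ht
          rw [lt_abs]; left; linarith
        simp only [hΦ]
        linarith
    have h0 := h Φ hΦs hΦc
    rw [hΦderiv] at h0
    have i1 : Integrable fun x => φ x • g x :=
      hg.integrable_smul_left_of_hasCompactSupport hφs.continuous hφc
    have i2 : Integrable fun x => η x • g x :=
      hg.integrable_smul_left_of_hasCompactSupport hηs.continuous hηc
    simp only [smul_eq_mul] at i1 i2 ⊢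
    have e1 : ∫ x, g x * θ x = (∫ x, φ x * g x) - m * ∫ x, η x * g x := by
      rw [← integral_const_mul, ← integral_sub i1 (i2.const_mul m)]
      congr 1; ext x; simp only [hθ]; ring
    have e2 : c = ∫ x, η x * g x := by simp only [hc, mul_comm]
    have e3 : ∫ x, φ x * ((g - fun _ => c) : ℝ → ℝ) x = (∫ x, φ x * g x) - c * m := by
      rw [hm, ← integral_const_mul, ← integral_sub i1 (hφi.const_mul c)]
      congr 1; ext x; simp only [Pi.sub_apply]; ring
    rw [e3]
    rw [h0] at e1
    rw [e2]; linarith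
  filter_upwards [key] with x hx using sub_eq_zero.mp hx

/-- A function with bounded weak derivative agrees almost everywhere with a Lipschitz function. -/
theorem HasWeakDeriv.exists_lipschitz {h u : ℝ → ℝ} (hu : HasWeakDeriv h u) {B : ℝ}
    (hB : ∀ᵐ x, |u x| ≤ B) :
    ∃ k : ℝ → ℝ, (∀ᵐ x, h x = k x) ∧ ∀ x y, |k x - k y| ≤ B * |x - y| := by
  obtain ⟨hh, hul, hw⟩ := hu
  have hui : ∀ a b, IntervalIntegrable u volume a b := fun a b =>
    (hul.integrableOn_isCompact isCompact_uIcc).intervalIntegrable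
  set k₀ : ℝ → ℝ := fun x => ∫ t in (0:ℝ)..x, u t with hk₀
  have hk₀sub : ∀ x y, k₀ x - k₀ y = ∫ t in y..x, u t := fun x y =>
    intervalIntegral.integral_interval_sub_left (hui 0 x) (hui 0 y)
  have hk₀L : ∀ x y, |k₀ x - k₀ y| ≤ B * |x - y| := by
    intro x y
    rw [hk₀sub, ← Real.norm_eq_abs]
    exact intervalIntegral.norm_integral_le_of_norm_le_const_ae
      (hB.mono fun t ht _ => ht)
  have hB0 : 0 ≤ B := by
    have := (abs_nonneg _).trans (hk₀L 1 0)
    simpa using this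
  have hk₀c : Continuous k₀ := by
    refine (LipschitzWith.of_dist_le_mul (K := B.toNNReal) fun x y => ?_).continuous
    rw [Real.dist_eq, Real.dist_eq, Real.coe_toNNReal _ hB0]; exact hk₀L x y
  -- The primitive `k₀` of u also has weak derivative u: it is Lipschitz, hence absolutely
  -- continuous, and integration by parts applies. So h - k₀ has weak derivative zero.
  have hparts : ∀ φ : ℝ → ℝ, ContDiff ℝ (⊤ : ℕ∞) φ → HasCompactSupport φ →
      ∫ x, k₀ x * deriv φ x = -∫ x, u x * φ x := by
    intro φ hφs hφc
    obtain ⟨R, hR⟩ : ∃ R : ℝ, ∀ x, R ≤ |x| → φ x = 0 := by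
      obtain ⟨R, hR⟩ := hφc.isCompact.isBounded.subset_closedBall 0
      refine ⟨|R| + 1, fun x hx => ?_⟩
      by_contra hne
      have := hR (subset_tsupport _ hne)
      simp only [Metric.mem_closedBall, dist_zero_right, Real.norm_eq_abs] at this
      linarith [le_abs_self R]
    have hsupp : ∀ w : ℝ → ℝ, Function.support (fun x => w x * φ x) ⊆ Set.Ioc (-(R + 1)) (R + 1) := by
      intro w x hx
      have hx' : ¬ R ≤ |x| := fun hc => hx (by simp [hR x hc])
      rw [not_le, abs_lt] at hx'
      exact ⟨by linarith [hx'.1], by linarith [hx'.2]⟩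
    have hsupp' : Function.support (fun x => k₀ x * deriv φ x) ⊆ Set.Ioc (-(R + 1)) (R + 1) := by
      intro x hx
      have hx' : ¬ R < |x| := by
        intro hc
        apply hx
        have : φ =ᶠ[𝓝 x] fun _ => 0 := by
          filter_upwards [(continuous_abs.tendsto x).eventually (lt_mem_nhds hc)] with y hy
          exact hR y hy.le
        simp [this.deriv_eq]
      rw [not_lt, abs_le] at hx'
      exact ⟨by linarith [hx'.1], by linarith [hx'.2]⟩
    have hac : AbsolutelyContinuousOnInterval k₀ (-(R + 1)) (R + 1) :=
      LipschitzOnWith.absolutelyContinuousOnInterval (K := B.toNNReal)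
        (LipschitzWith.of_dist_le_mul fun x y => by
          rw [Real.dist_eq, Real.dist_eq, Real.coe_toNNReal _ hB0]; exact hk₀L x y).lipschitzOnWith
    have hac' : AbsolutelyContinuousOnInterval φ (-(R + 1)) (R + 1) :=
      (hφs.of_le (by simp)).contDiffOn.absolutelyContinuousOnInterval
    have := hac.integral_mul_deriv_eq_deriv_mul hac'
    rw [hR (R + 1) (by linarith [le_abs_self (R + 1)]),
      hR (-(R + 1)) (by rw [abs_neg]; linarith [le_abs_self (R + 1)])] at this
    rw [← intervalIntegral.integral_eq_integral_of_support_subset hsupp',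
      ← intervalIntegral.integral_eq_integral_of_support_subset (hsupp u), this]
    simp only [mul_zero, sub_zero, zero_sub, neg_inj]
    apply intervalIntegral.integral_congr_ae
    filter_upwards [LocallyIntegrable.ae_hasDerivAt_integral hul] with x hx _
    rw [(hx 0).deriv]
  obtain ⟨c, hc⟩ := ae_eq_const_of_integral_mul_deriv_eq_zero
    (g := fun x => h x - k₀ x) (hh.sub hk₀c.locallyIntegrable) (by
      intro φ hφs hφc
      have hd : Continuous (deriv φ) := hφs.continuous_deriv (by simp)
      have i1 : Integrable fun x => h x * deriv φ x := by
        simpa [mul_comm] using hh.integrable_smul_left_of_hasCompactSupport hd hφc.deriv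
      have i2 : Integrable fun x => k₀ x * deriv φ x := by
        simpa [mul_comm] using
          hk₀c.locallyIntegrable.integrable_smul_left_of_hasCompactSupport hd hφc.deriv
      simp only [sub_mul]
      rw [integral_sub i1 i2, hw φ hφs hφc, hparts φ hφs hφc, sub_self])
  refine ⟨fun x => k₀ x + c, ?_, fun x y => by simpa using hk₀L x y⟩
  filter_upwards [hc] with x hx
  linarith

/-! ### Analytic extension to the upper half plane -/

noncomputable section

/-- The normalised Cauchy kernel `1/(z-t) + t/(t²+1)`. -/
def cauchyKernel (z : ℂ) (t : ℝ) : ℂ := 1 / (z - t) + t / (t ^ 2 + 1)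

/-- The analytic function on the upper half plane whose real part is the Poisson integral of `f`. -/
def analyticExtension (f : ℝ → ℝ) (z : ℂ) : ℂ :=
  Complex.I / Real.pi * ∫ t : ℝ, (f t : ℂ) * cauchyKernel z t

end

theorem im_le_norm_sub_ofReal {z : ℂ} (hz : 0 < z.im) (t : ℝ) : z.im ≤ ‖z - t‖ := by
  have := Complex.abs_im_le_norm (z - t)
  simpa [abs_of_pos hz] using this

theorem sub_ofReal_ne_zero {z : ℂ} (hz : 0 < z.im) (t : ℝ) : z - t ≠ 0 :=
  norm_pos_iff.mp (hz.trans_le (im_le_norm_sub_ofReal hz t))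

theorem ofReal_sq_add_one_ne_zero (t : ℝ) : (t : ℂ) ^ 2 + 1 ≠ 0 := by
  exact_mod_cast (by positivity : t ^ 2 + 1 ≠ 0)

/-- The term t/(t²+1) cancels the 1/t tail of the Cauchy kernel: the sum equals ((1+z²)/(z-t) -
z)/(1+t²). This decay is exactly what the weight in the hypothesis on f can integrate. -/
theorem norm_cauchyKernel_le {z : ℂ} (hz : 0 < z.im) (t : ℝ) :
    ‖cauchyKernel z t‖ ≤ ((1 + ‖z‖ ^ 2) / z.im + ‖z‖) * (1 / (1 + t ^ 2)) := by
  have h1 := sub_ofReal_ne_zero hz t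
  have h2 := ofReal_sq_add_one_ne_zero t
  have e : cauchyKernel z t = ((1 + z ^ 2) / (z - t) - z) * (1 / (t ^ 2 + 1)) := by
    unfold cauchyKernel; field_simp; ring
  have h3 : ‖(1 / ((t : ℂ) ^ 2 + 1))‖ = 1 / (1 + t ^ 2) := by
    rw [show (1 / ((t : ℂ) ^ 2 + 1)) = ((1 / (1 + t ^ 2) : ℝ) : ℂ) by push_cast; ring,
      Complex.norm_real, Real.norm_of_nonneg (by positivity)]
  rw [e, norm_mul, h3]
  gcongr
  refine (norm_sub_le _ _).trans ?_
  gcongr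
  rw [norm_div]
  gcongr
  · refine (norm_add_le _ _).trans ?_
    simp
  · exact im_le_norm_sub_ofReal hz t

theorem measurable_cauchyKernel (z : ℂ) : Measurable (cauchyKernel z) := by
  unfold cauchyKernel; fun_prop

section

variable {f : ℝ → ℝ}

theorem aestronglyMeasurable_of_weighted (hf : Integrable fun t => f t / (1 + t ^ 2)) :
    AEStronglyMeasurable f := by
  have h := hf.aestronglyMeasurable.mul
    (f := fun t => f t / (1 + t ^ 2)) (g := fun t : ℝ => 1 + t ^ 2) (by fun_prop)
  refine h.congr (ae_of_all _ fun t => ?_)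
  simp only [Pi.mul_apply]
  field_simp

theorem integrable_mul_of_le (hf : Integrable fun t => f t / (1 + t ^ 2)) {k : ℝ → ℝ} {C : ℝ}
    (hk : AEStronglyMeasurable k) (hC : ∀ t, |k t| ≤ C * (1 / (1 + t ^ 2))) :
    Integrable fun t => f t * k t := by
  refine (hf.norm.const_mul C).mono' ((aestronglyMeasurable_of_weighted hf).mul hk) ?_
  refine ae_of_all _ fun t => ?_
  rw [norm_mul, norm_div, Real.norm_eq_abs, Real.norm_eq_abs, Real.norm_eq_abs,
    abs_of_pos (by positivity : 0 < 1 + t ^ 2)]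
  calc |f t| * |k t| ≤ |f t| * (C * (1 / (1 + t ^ 2))) := by gcongr; exact hC t
    _ = _ := by ring

theorem integrable_mul_cauchyKernel (hf : Integrable fun t => f t / (1 + t ^ 2)) {z : ℂ}
    (hz : 0 < z.im) : Integrable fun t : ℝ => (f t : ℂ) * cauchyKernel z t := by
  apply (hf.norm.const_mul ((1 + ‖z‖ ^ 2) / z.im + ‖z‖)).mono'
  · exact (Complex.continuous_ofReal.comp_aestronglyMeasurable
      (aestronglyMeasurable_of_weighted hf)).mul (measurable_cauchyKernel z).aestronglyMeasurable
  refine ae_of_all _ fun t => ?_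
  simp only [norm_mul, norm_div, Real.norm_eq_abs, Complex.norm_real]
  rw [abs_of_pos (by positivity : 0 < 1 + t ^ 2)]
  calc |f t| * ‖cauchyKernel z t‖
      ≤ |f t| * (((1 + ‖z‖ ^ 2) / z.im + ‖z‖) * (1 / (1 + t ^ 2))) := by
        gcongr; exact norm_cauchyKernel_le hz t
    _ = _ := by ring

/-- The bound is uniform for z in a bounded set away from the real line, so it serves as the
dominating function when differentiating under the integral. -/
theorem norm_inv_sq_sub_le {z : ℂ} {R y : ℝ} (hy : 0 < y) (hz : y ≤ z.im) (hR : ‖z‖ ≤ R) (t : ℝ) :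
    ‖-1 / (z - t) ^ 2‖ ≤ ((1 + 2 * R ^ 2) / y ^ 2 + 2) * (1 / (1 + t ^ 2)) := by
  have h1 : y ≤ ‖z - t‖ := hz.trans (im_le_norm_sub_ofReal (hy.trans_le hz) t)
  have h2 : |t| ≤ R + ‖z - t‖ := by
    calc |t| = ‖z - (z - t)‖ := by simp
      _ ≤ _ := (norm_sub_le _ _).trans (by gcongr)
  have hpos : 0 < ‖z - t‖ := hy.trans_le h1
  rw [norm_div, norm_neg, norm_one, norm_pow, mul_one_div, div_le_div_iff₀ (by positivity)
    (by positivity), one_mul]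
  have h3 : t ^ 2 ≤ 2 * R ^ 2 + 2 * ‖z - t‖ ^ 2 := by
    rw [← sq_abs]
    nlinarith [abs_nonneg t, sq_nonneg (R - ‖z - t‖)]
  have h4 : (1 + 2 * R ^ 2) ≤ (1 + 2 * R ^ 2) / y ^ 2 * ‖z - t‖ ^ 2 := by
    rw [div_mul_eq_mul_div, le_div_iff₀ (by positivity)]
    gcongr
  linarith

theorem hasDerivAt_analyticExtension (hf : Integrable fun t => f t / (1 + t ^ 2)) {z : ℂ}
    (hz : 0 < z.im) : HasDerivAt (analyticExtension f)
      (Complex.I / Real.pi * ∫ t : ℝ, (f t : ℂ) * (-1 / (z - t) ^ 2)) z := by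
  unfold analyticExtension
  apply HasDerivAt.const_mul
  have hy : 0 < z.im / 2 := by linarith
  have him : ∀ w ∈ Metric.ball z (z.im / 2), z.im / 2 ≤ w.im := by
    intro w hw
    have := (Complex.abs_im_le_norm (w - z)).trans (mem_ball_iff_norm.mp hw).le
    rw [Complex.sub_im, abs_le] at this
    linarith [this.1]
  have hn : ∀ w ∈ Metric.ball z (z.im / 2), ‖w‖ ≤ ‖z‖ + z.im / 2 := by
    intro w hw
    have := norm_sub_norm_le w z
    have := mem_ball_iff_norm.mp hw
    linarith
  have hfm := Complex.continuous_ofReal.comp_aestronglyMeasurable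
    (aestronglyMeasurable_of_weighted hf)
  refine (hasDerivAt_integral_of_dominated_loc_of_deriv_le (Metric.ball_mem_nhds z hy)
    (F := fun w (t : ℝ) => (f t : ℂ) * cauchyKernel w t)
    (F' := fun w (t : ℝ) => (f t : ℂ) * (-1 / (w - t) ^ 2))
    (bound := fun t => ((1 + 2 * (‖z‖ + z.im / 2) ^ 2) / (z.im / 2) ^ 2 + 2)
      * ‖f t / (1 + t ^ 2)‖) ?_ ?_ ?_ ?_ ?_ ?_).2
  · exact Eventually.of_forall fun w => hfm.mul (measurable_cauchyKernel w).aestronglyMeasurable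
  · exact integrable_mul_cauchyKernel hf hz
  · exact hfm.mul (by fun_prop : Measurable fun t : ℝ => -1 / (z - t) ^ 2).aestronglyMeasurable
  · refine ae_of_all _ fun t w hw => ?_
    simp only [norm_mul, Complex.norm_real]
    rw [norm_div (f t), Real.norm_of_nonneg (by positivity : 0 ≤ 1 + t ^ 2)]
    calc ‖f t‖ * ‖-1 / (w - t) ^ 2‖ ≤ ‖f t‖ *
        (((1 + 2 * (‖z‖ + z.im / 2) ^ 2) / (z.im / 2) ^ 2 + 2) * (1 / (1 + t ^ 2))) := by
          gcongr; exact norm_inv_sq_sub_le hy (him w hw) (hn w hw) t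
      _ = _ := by ring
  · exact hf.norm.const_mul _
  · refine ae_of_all _ fun t w hw => ?_
    apply HasDerivAt.const_mul
    unfold cauchyKernel
    have := ((hasDerivAt_id w).sub_const (t : ℂ)).fun_inv
      (sub_ofReal_ne_zero (hy.trans_le (him w hw)) t)
    simpa [one_div] using this.add_const ((t : ℂ) / (t ^ 2 + 1))

theorem cauchyKernel_add_mul_I (x t : ℝ) {y : ℝ} (hy : 0 < y) :
    cauchyKernel (x + y * Complex.I) t =
      (((x - t) / ((x - t) ^ 2 + y ^ 2) + t / (t ^ 2 + 1) : ℝ) : ℂ)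
        - ((y / ((x - t) ^ 2 + y ^ 2) : ℝ) : ℂ) * Complex.I := by
  have h1 : ((x : ℂ) + y * Complex.I - t) ≠ 0 := sub_ofReal_ne_zero (by simpa using hy) t
  have h2 : ((x : ℂ) - t) ^ 2 + y ^ 2 ≠ 0 := by
    exact_mod_cast (by positivity : (x - t) ^ 2 + y ^ 2 ≠ 0)
  have h3 : (1 : ℂ) / ((x : ℂ) + y * Complex.I - t) =
      ((x : ℂ) - t - y * Complex.I) / (((x : ℂ) - t) ^ 2 + y ^ 2) := by
    rw [div_eq_div_iff h1 h2]
    linear_combination ((y : ℂ) ^ 2) * Complex.I_sq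
  unfold cauchyKernel
  rw [h3]
  push_cast
  ring

theorem abs_conjKernel_le {y : ℝ} (hy : 0 < y) (x t : ℝ) :
    |(x - t) / ((x - t) ^ 2 + y ^ 2) + t / (t ^ 2 + 1)|
      ≤ ((1 + ‖(x + y * Complex.I : ℂ)‖ ^ 2) / y + ‖(x + y * Complex.I : ℂ)‖)
        * (1 / (1 + t ^ 2)) := by
  have h := norm_cauchyKernel_le (z := x + y * Complex.I) (by simpa using hy) t
  have h2 := (Complex.abs_re_le_norm _).trans h
  rw [cauchyKernel_add_mul_I x t hy] at h2
  simpa only [Complex.sub_re, Complex.ofReal_re, Complex.re_ofReal_mul, Complex.I_re, mul_zero,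
    sub_zero, Complex.add_im, Complex.ofReal_im, Complex.im_ofReal_mul, Complex.I_im, mul_one,
    zero_add] using h2

theorem abs_poissonKernel_le {y : ℝ} (hy : 0 < y) (x t : ℝ) :
    |y / ((x - t) ^ 2 + y ^ 2)|
      ≤ ((1 + ‖(x + y * Complex.I : ℂ)‖ ^ 2) / y + ‖(x + y * Complex.I : ℂ)‖)
        * (1 / (1 + t ^ 2)) := by
  have h := norm_cauchyKernel_le (z := x + y * Complex.I) (by simpa using hy) t
  have h2 := (Complex.abs_im_le_norm _).trans h
  rw [cauchyKernel_add_mul_I x t hy] at h2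
  simpa only [Complex.sub_im, Complex.ofReal_im, Complex.im_ofReal_mul, Complex.I_im, mul_one,
    zero_sub, abs_neg, Complex.add_im, zero_add] using h2

theorem integrable_mul_conjKernel (hf : Integrable fun t => f t / (1 + t ^ 2)) (x : ℝ) {y : ℝ}
    (hy : 0 < y) :
    Integrable fun t => f t * ((x - t) / ((x - t) ^ 2 + y ^ 2) + t / (t ^ 2 + 1)) :=
  integrable_mul_of_le hf (by fun_prop : Measurable _).aestronglyMeasurable
    fun t => abs_conjKernel_le hy x t

theorem integrable_mul_poissonKernel (hf : Integrable fun t => f t / (1 + t ^ 2)) (x : ℝ) {y : ℝ}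
    (hy : 0 < y) : Integrable fun t => f t * (y / ((x - t) ^ 2 + y ^ 2)) :=
  integrable_mul_of_le hf (by fun_prop : Measurable _).aestronglyMeasurable
    fun t => abs_poissonKernel_le hy x t

theorem analyticExtension_add_mul_I (hf : Integrable fun t => f t / (1 + t ^ 2)) (x : ℝ) {y : ℝ}
    (hy : 0 < y) : analyticExtension f (x + y * Complex.I) =
      ((1 / Real.pi * ∫ t, f t * (y / ((x - t) ^ 2 + y ^ 2)) : ℝ) : ℂ)
      + ((1 / Real.pi * ∫ t, f t * ((x - t) / ((x - t) ^ 2 + y ^ 2) + t / (t ^ 2 + 1)) : ℝ) : ℂ)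
        * Complex.I := by
  unfold analyticExtension
  have e : ∀ t : ℝ, (f t : ℂ) * cauchyKernel (x + y * Complex.I) t =
      ((f t * ((x - t) / ((x - t) ^ 2 + y ^ 2) + t / (t ^ 2 + 1)) : ℝ) : ℂ)
        - ((f t * (y / ((x - t) ^ 2 + y ^ 2)) : ℝ) : ℂ) * Complex.I := by
    intro t
    rw [cauchyKernel_add_mul_I x t hy]; push_cast; ring
  simp_rw [e]
  rw [integral_sub (integrable_mul_conjKernel hf x hy).ofReal
    ((integrable_mul_poissonKernel hf x hy).ofReal.mul_const _), integral_mul_const,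
    integral_complex_ofReal, integral_complex_ofReal]
  push_cast
  linear_combination (-(1 / (Real.pi : ℂ)) *
    ((∫ t, f t * (y / ((x - t) ^ 2 + y ^ 2)) : ℝ) : ℂ)) * Complex.I_sq

end

/-! ### Boundary values: Poisson means, conjugate Poisson means, principal values -/

/-- For the least k with |u| ≤ 2^k·y, the lower bound |u| > 2^(k-1)·y (or u² + y² ≥ y² when k = 0)
shows that the k-th term alone dominates the kernel. -/
theorem poissonKernel_le_sum_dyadic {y u : ℝ} (hy : 0 < y) {N : ℕ} (hN : |u| ≤ 2 ^ N * y) :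
    y / (u ^ 2 + y ^ 2) ≤
      ∑ k ∈ Finset.range (N + 1), if |u| ≤ 2 ^ k * y then 4 / (4 ^ k * y) else 0 := by
  have hex : ∃ k, |u| ≤ 2 ^ k * y := ⟨N, hN⟩
  classical
  set k := Nat.find hex with hk
  have hku : |u| ≤ 2 ^ k * y := Nat.find_spec hex
  have hkN : k ≤ N := Nat.find_min' hex hN
  have hle : y / (u ^ 2 + y ^ 2) ≤ 4 / (4 ^ k * y) := by
    rw [div_le_div_iff₀ (by positivity) (by positivity)]
    rcases Nat.eq_zero_or_pos k with h0 | h0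
    · rw [h0]; nlinarith [sq_nonneg u]
    · have h1 : ¬ |u| ≤ 2 ^ (k - 1) * y := Nat.find_min hex (by omega)
      have h2 : (2 ^ (k - 1) * y) ^ 2 ≤ u ^ 2 := by
        rw [← sq_abs u]
        exact pow_le_pow_left₀ (by positivity) (not_le.mp h1).le 2
      have h3 : (4 : ℝ) ^ k = 4 * (2 ^ (k - 1)) ^ 2 := by
        obtain ⟨m, hm⟩ : ∃ m, k = m + 1 := ⟨k - 1, by omega⟩
        rw [hm, Nat.add_sub_cancel, pow_succ, ← pow_mul, mul_comm m 2, pow_mul]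
        norm_num; ring
      rw [h3]
      nlinarith [sq_nonneg y]
  refine hle.trans ?_
  have := Finset.single_le_sum (s := Finset.range (N + 1))
    (f := fun k => if |u| ≤ 2 ^ k * y then 4 / (4 ^ k * y) else 0)
    (fun i _ => by split_ifs <;> positivity) (Finset.mem_range.mpr (Nat.lt_succ_of_le hkN))
  simpa [hku] using this

/-- The dyadic majorant reduces the Poisson mean to averages over balls: the k-th one contributes at
most 8ε·2⁻ᵏ, and the geometric series sums to 16ε. -/
theorem setIntegral_mul_poissonKernel_le {g : ℝ → ℝ} {x δ ε y : ℝ} (hg0 : ∀ t, 0 ≤ g t)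
    (hδ : 0 < δ) (hy : 0 < y) (hε : 0 ≤ ε) (hgi : IntegrableOn g (Metric.closedBall x δ))
    (hgP : IntegrableOn (fun t => g t * (y / ((x - t) ^ 2 + y ^ 2))) (Metric.closedBall x δ))
    (hg : ∀ r, 0 < r → r ≤ δ → ∫ t in Metric.closedBall x r, g t ≤ 2 * ε * r) :
    ∫ t in Metric.closedBall x δ, g t * (y / ((x - t) ^ 2 + y ^ 2)) ≤ 16 * ε := by
  obtain ⟨N, hN⟩ : ∃ N : ℕ, δ ≤ 2 ^ N * y := by
    obtain ⟨N, hN⟩ := pow_unbounded_of_one_lt (δ / y) one_lt_two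
    exact ⟨N, ((div_lt_iff₀ hy).mp hN).le⟩
  have hmeas : ∀ r : ℝ, MeasurableSet (Metric.closedBall x r) := fun r =>
    Metric.isClosed_closedBall.measurableSet
  have hmem : ∀ t r : ℝ, |x - t| ≤ r ↔ t ∈ Metric.closedBall x r := by
    intro t r
    rw [Metric.mem_closedBall, Real.dist_eq, abs_sub_comm]
  have hi : ∀ k : ℕ, IntegrableOn (fun t => 4 / (4 ^ k * y) *
      (Metric.closedBall x (2 ^ k * y)).indicator g t) (Metric.closedBall x δ) := fun k =>
    (hgi.indicator (hmeas _)).const_mul _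
  calc ∫ t in Metric.closedBall x δ, g t * (y / ((x - t) ^ 2 + y ^ 2))
      ≤ ∫ t in Metric.closedBall x δ, ∑ k ∈ Finset.range (N + 1), 4 / (4 ^ k * y) *
          (Metric.closedBall x (2 ^ k * y)).indicator g t := by
        apply setIntegral_mono_on hgP (integrable_finsetSum _ fun k _ => hi k) (hmeas _)
        intro t ht
        have h1 := poissonKernel_le_sum_dyadic (u := x - t) hy (((hmem t δ).mpr ht).trans hN)
        refine (mul_le_mul_of_nonneg_left h1 (hg0 t)).trans (le_of_eq ?_)
        rw [Finset.mul_sum]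
        refine Finset.sum_congr rfl fun k _ => ?_
        by_cases h : |x - t| ≤ 2 ^ k * y
        · rw [if_pos h, Set.indicator_of_mem ((hmem _ _).mp h)]; ring
        · rw [if_neg h, Set.indicator_of_notMem fun h' => h ((hmem _ _).mpr h')]; ring
    _ = ∑ k ∈ Finset.range (N + 1), 4 / (4 ^ k * y) *
          ∫ t in Metric.closedBall x δ, (Metric.closedBall x (2 ^ k * y)).indicator g t := by
        rw [integral_finsetSum _ fun k _ => hi k]
        refine Finset.sum_congr rfl fun k _ => ?_
        rw [integral_const_mul]
    _ ≤ ∑ k ∈ Finset.range (N + 1), 8 * ε * (1 / 2) ^ k := by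
        refine Finset.sum_le_sum fun k _ => ?_
        rw [setIntegral_indicator (hmeas _)]
        have hinter : Metric.closedBall x δ ∩ Metric.closedBall x (2 ^ k * y)
            = Metric.closedBall x (min δ (2 ^ k * y)) := by
          ext t; simp
        rw [hinter]
        have h1 := hg (min δ (2 ^ k * y)) (by positivity) (min_le_left _ _)
        have h2 : 2 * ε * min δ (2 ^ k * y) ≤ 2 * ε * (2 ^ k * y) := by
          gcongr; exact min_le_right _ _
        calc _ ≤ 4 / (4 ^ k * y) * (2 * ε * (2 ^ k * y)) := by gcongr; exact h1.trans h2
          _ = _ := by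
            rw [show (4 : ℝ) ^ k = 2 ^ k * 2 ^ k by rw [← mul_pow]; norm_num, one_div, inv_pow]
            field_simp; norm_num; ring
    _ ≤ 16 * ε := by
        rw [← Finset.mul_sum]
        have : ∑ k ∈ Finset.range (N + 1), (1 / 2 : ℝ) ^ k ≤ 2 := by
          have := (summable_geometric_two).sum_le_tsum (Finset.range (N + 1))
            (fun i _ => by positivity)
          rwa [tsum_geometric_two] at this
        nlinarith

theorem integrable_abs_sub_const_div {f : ℝ → ℝ} (hf : Integrable fun t => f t / (1 + t ^ 2))
    (c : ℝ) : Integrable fun t => |f t - c| / (1 + t ^ 2) := by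
  have h := (hf.sub (integrable_inv_one_add_sq.const_mul c)).abs
  refine h.congr (ae_of_all _ fun t => ?_)
  simp only [Pi.sub_apply]
  rw [← div_eq_mul_inv, ← sub_div, abs_div, abs_of_pos (by positivity : 0 < 1 + t ^ 2)]

theorem locallyIntegrable_of_weighted {f : ℝ → ℝ} (hf : Integrable fun t => f t / (1 + t ^ 2)) :
    LocallyIntegrable f := by
  have h : LocallyIntegrable fun t => (1 + t ^ 2) • (f t / (1 + t ^ 2)) :=
    hf.locallyIntegrable.continuous_smul (by fun_prop)
  refine h.congr (ae_of_all _ fun t => ?_)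
  simp only [smul_eq_mul]
  field_simp

/-- Almost every point is a Lebesgue point in the sense of Poisson means. -/
theorem ae_tendsto_integral_abs_sub_mul_poissonKernel {f : ℝ → ℝ}
    (hf : Integrable fun t => f t / (1 + t ^ 2)) :
    ∀ᵐ x : ℝ, Tendsto (fun y : ℝ => ∫ t, |f t - f x| * (y / ((x - t) ^ 2 + y ^ 2)))
      (𝓝[>] 0) (𝓝 0) := by
  filter_upwards [IsUnifLocDoublingMeasure.ae_tendsto_average_norm_sub volume
    (locallyIntegrable_of_weighted hf) 1] with x hx
  have hav := hx (l := 𝓝[>] (0 : ℝ)) (fun _ => x) id tendsto_id (by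
    filter_upwards [self_mem_nhdsWithin] with r hr
    simpa using le_of_lt hr)
  have hw := integrable_abs_sub_const_div hf (f x)
  have hP : ∀ y : ℝ, 0 < y → Integrable fun t => |f t - f x| * (y / ((x - t) ^ 2 + y ^ 2)) :=
    fun y hy => integrable_mul_poissonKernel hw x hy
  have hP0 : ∀ y : ℝ, 0 < y → ∀ t, 0 ≤ |f t - f x| * (y / ((x - t) ^ 2 + y ^ 2)) :=
    fun y hy t => by positivity
  rw [Metric.tendsto_nhds]
  intro ε hε
  -- The near part costs 16 times this, that is ε/2; the far part gets the other half.
  have hε' : 0 < ε / 32 := by positivity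
  have h1 := (Metric.tendsto_nhds.mp hav) (ε / 32) hε'
  rw [eventually_nhdsWithin_iff, Metric.eventually_nhds_iff] at h1
  obtain ⟨δ', hδ', h1⟩ := h1
  set δ := δ' / 2 with hδdef
  have hδ : 0 < δ := by positivity
  have hball : ∀ r, 0 < r → r ≤ δ →
      ∫ t in Metric.closedBall x r, |f t - f x| ≤ 2 * (ε / 32) * r := by
    intro r hr hrδ
    have h2 := h1 (y := r) (by rw [Real.dist_eq, sub_zero, abs_of_pos hr]; linarith) hr
    simp only [id, Real.dist_eq, sub_zero] at h2
    have h3 := (le_abs_self _).trans h2.le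
    rw [setAverage_eq, measureReal_def, Real.volume_closedBall, ENNReal.toReal_ofReal (by linarith),
      smul_eq_mul, inv_mul_le_iff₀ (by linarith)] at h3
    simp only [Real.norm_eq_abs] at h3
    linarith
  set I := ∫ t, |f t - f x| * (δ / ((x - t) ^ 2 + δ ^ 2)) with hI
  have hlim : Tendsto (fun y : ℝ => y * (2 / δ) * I) (𝓝[>] 0) (𝓝 0) := by
    have : Tendsto (fun y : ℝ => y * (2 / δ) * I) (𝓝 0) (𝓝 (0 * (2 / δ) * I)) :=
      Continuous.tendsto (by fun_prop) 0
    simp only [zero_mul] at this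
    exact this.mono_left nhdsWithin_le_nhds
  filter_upwards [self_mem_nhdsWithin, hlim.eventually (gt_mem_nhds (by linarith : 0 < ε / 2))]
    with y hy hyI
  have hy : 0 < y := hy
  have hms : MeasurableSet (Metric.closedBall x δ) := Metric.isClosed_closedBall.measurableSet
  rw [Real.dist_eq, sub_zero, abs_of_nonneg (integral_nonneg (hP0 y hy)),
    ← integral_add_compl hms (hP y hy)]
  have hnear := setIntegral_mul_poissonKernel_le (g := fun t => |f t - f x|) (fun t => abs_nonneg _)
    hδ hy hε'.le (((locallyIntegrable_of_weighted hf).sub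
      (locallyIntegrable_const (f x))).integrableOn_isCompact (isCompact_closedBall x δ)).abs
    (hP y hy).integrableOn hball
  -- Off the ball of radius δ, the kernel at height y is at most 2y/δ times the kernel at the fixed
  -- height δ, whose integral `I` is finite.
  have hfar : ∫ t in (Metric.closedBall x δ)ᶜ, |f t - f x| * (y / ((x - t) ^ 2 + y ^ 2))
      ≤ y * (2 / δ) * I := by
    rw [hI, ← integral_const_mul]
    refine (setIntegral_mono_on (hP y hy).integrableOn
      ((hP δ hδ).const_mul (y * (2 / δ))).integrableOn hms.compl ?_).trans
      (setIntegral_le_integral ((hP δ hδ).const_mul _)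
        (ae_of_all _ fun t => mul_nonneg (by positivity) (hP0 δ hδ t)))
    intro t ht
    rw [Set.mem_compl_iff, Metric.mem_closedBall, not_le, Real.dist_eq, abs_sub_comm] at ht
    have h5 : δ ^ 2 ≤ (x - t) ^ 2 := by
      rw [← sq_abs (x - t)]
      exact pow_le_pow_left₀ hδ.le ht.le 2
    have h6 : y / ((x - t) ^ 2 + y ^ 2) ≤ y * (2 / δ) * (δ / ((x - t) ^ 2 + δ ^ 2)) := by
      rw [show y * (2 / δ) * (δ / ((x - t) ^ 2 + δ ^ 2)) = 2 * y / ((x - t) ^ 2 + δ ^ 2) by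
        field_simp, div_le_div_iff₀ (by positivity) (by positivity)]
      nlinarith [mul_nonneg hy.le (sub_nonneg.mpr h5), mul_pos hy (pow_pos hy 2)]
    calc _ ≤ |f t - f x| * (y * (2 / δ) * (δ / ((x - t) ^ 2 + δ ^ 2))) := by gcongr
      _ = _ := by ring
  linarith

theorem integral_poissonKernel (x : ℝ) {y : ℝ} (hy : 0 < y) :
    ∫ t, y / ((x - t) ^ 2 + y ^ 2) = Real.pi := by
  have e : ∀ t : ℝ, y / ((x - t) ^ 2 + y ^ 2) = y⁻¹ * (fun s : ℝ => (1 + (s / y) ^ 2)⁻¹) (x - t) := by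
    intro t
    have : (x - t) ^ 2 + y ^ 2 ≠ 0 := by positivity
    simp only
    field_simp
    ring
  simp_rw [e]
  rw [integral_const_mul, integral_sub_left_eq_self (fun s : ℝ => (1 + (s / y) ^ 2)⁻¹),
    Measure.integral_comp_div (fun s : ℝ => (1 + s ^ 2)⁻¹), integral_univ_inv_one_add_sq,
    abs_of_pos hy, smul_eq_mul]
  field_simp

theorem tendsto_poissonIntegral {f : ℝ → ℝ} (hf : Integrable fun t => f t / (1 + t ^ 2)) {x : ℝ}
    (hx : Tendsto (fun y : ℝ => ∫ t, |f t - f x| * (y / ((x - t) ^ 2 + y ^ 2))) (𝓝[>] 0) (𝓝 0)) :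
    Tendsto (fun y : ℝ => 1 / Real.pi * ∫ t, f t * (y / ((x - t) ^ 2 + y ^ 2)))
      (𝓝[>] 0) (𝓝 (f x)) := by
  have hw : Integrable fun t => (fun _ => f x) t / (1 + t ^ 2) := by
    simpa [div_eq_mul_inv] using integrable_inv_one_add_sq.const_mul (f x)
  rw [tendsto_iff_norm_sub_tendsto_zero]
  have hx' : Tendsto (fun y : ℝ => 1 / Real.pi *
      ∫ t, |f t - f x| * (y / ((x - t) ^ 2 + y ^ 2))) (𝓝[>] 0) (𝓝 0) := by
    simpa using hx.const_mul (1 / Real.pi)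
  refine squeeze_zero' (Eventually.of_forall fun _ => norm_nonneg _) ?_ hx'
  filter_upwards [self_mem_nhdsWithin] with y hy
  have hy : 0 < y := hy
  have hπ := Real.pi_pos
  have e : (1 / Real.pi * ∫ t, f t * (y / ((x - t) ^ 2 + y ^ 2))) - f x
      = 1 / Real.pi * ∫ t, (f t - f x) * (y / ((x - t) ^ 2 + y ^ 2)) := by
    simp_rw [sub_mul]
    rw [integral_sub (integrable_mul_poissonKernel hf x hy) (integrable_mul_poissonKernel hw x hy),
      integral_const_mul, integral_poissonKernel x hy, mul_sub, mul_comm (f x), one_div,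
      inv_mul_cancel_left₀ hπ.ne']
  rw [e, norm_mul, Real.norm_of_nonneg (by positivity : 0 ≤ 1 / Real.pi)]
  gcongr
  refine (norm_integral_le_integral_norm _).trans (le_of_eq ?_)
  congr 1; ext t
  rw [norm_mul, Real.norm_eq_abs, Real.norm_of_nonneg (by positivity)]

/-- The difference between the conjugate Poisson kernel and the truncated Hilbert kernel. -/
theorem abs_conjKernel_sub_trunc_le {y : ℝ} (hy : 0 < y) (u : ℝ) :
    |u / (u ^ 2 + y ^ 2) - if y ≤ |u| then 1 / u else 0| ≤ y / (u ^ 2 + y ^ 2) := by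
  have hp : 0 < u ^ 2 + y ^ 2 := by positivity
  split_ifs with h
  · have hu : u ≠ 0 := by rintro rfl; simp at h; linarith
    have e : u / (u ^ 2 + y ^ 2) - 1 / u = (-(y ^ 2 / u)) / (u ^ 2 + y ^ 2) := by
      field_simp; ring
    rw [e, abs_div, abs_of_pos hp, abs_neg, abs_div, abs_of_pos (by positivity : 0 < y ^ 2)]
    gcongr
    rw [div_le_iff₀ (abs_pos.mpr hu)]
    nlinarith
  · rw [sub_zero, abs_div, abs_of_pos hp]
    gcongr
    exact (not_le.mp h).le

/-- At a Poisson–Lebesgue point, conjugate Poisson means and truncated Hilbert transforms have the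
same limit. -/
theorem tendsto_conjPoissonIntegral {f : ℝ → ℝ} (hf : Integrable fun t => f t / (1 + t ^ 2))
    {x l : ℝ}
    (hx : Tendsto (fun y : ℝ => ∫ t, |f t - f x| * (y / ((x - t) ^ 2 + y ^ 2))) (𝓝[>] 0) (𝓝 0))
    (hl : Tendsto (fun ε : ℝ => truncModifiedHilbert f ε x) (𝓝[>] 0) (𝓝 l)) :
    Tendsto (fun y : ℝ =>
      1 / Real.pi * ∫ t, f t * ((x - t) / ((x - t) ^ 2 + y ^ 2) + t / (t ^ 2 + 1)))
      (𝓝[>] 0) (𝓝 l) := by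
  have hπ := Real.pi_pos
  have hw := integrable_abs_sub_const_div hf (f x)
  have hwc : Integrable fun t => (fun _ => f x) t / (1 + t ^ 2) := by
    simpa [div_eq_mul_inv] using integrable_inv_one_add_sq.const_mul (f x)
  suffices hd : Tendsto (fun y : ℝ =>
      (1 / Real.pi * ∫ t, f t * ((x - t) / ((x - t) ^ 2 + y ^ 2) + t / (t ^ 2 + 1)))
        - truncModifiedHilbert f y x) (𝓝[>] 0) (𝓝 0) by
    simpa using hd.add hl
  -- The conjugate kernel minus the truncated one is `D + E`. `D` is odd about x, so f may be
  -- replaced by f - f(x), and it is dominated by the Poisson kernel `P`. `E` is the term t/(t²+1)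
  -- left over on |x - t| < y; there 2yP ≥ 1, so it is O(y) relative to `P`.
  set P : ℝ → ℝ → ℝ := fun y t => y / ((x - t) ^ 2 + y ^ 2) with hP
  set D : ℝ → ℝ → ℝ := fun y t => (x - t) / ((x - t) ^ 2 + y ^ 2)
    - if y ≤ |x - t| then 1 / (x - t) else 0 with hD
  set E : ℝ → ℝ → ℝ := fun y t => if y ≤ |x - t| then 0 else t / (t ^ 2 + 1) with hE
  have hms : ∀ y : ℝ, MeasurableSet {t : ℝ | y ≤ |x - t|} := fun y =>
    measurableSet_le measurable_const (by fun_prop)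
  have hDm : ∀ y, Measurable (D y) := fun y =>
    (by fun_prop : Measurable fun t : ℝ => (x - t) / ((x - t) ^ 2 + y ^ 2)).sub
      (Measurable.ite (hms y) (by fun_prop) measurable_const)
  have hEm : ∀ y, Measurable (E y) := fun y =>
    Measurable.ite (hms y) measurable_const (by fun_prop)
  have hDP : ∀ y, 0 < y → ∀ t, |D y t| ≤ P y t := fun y hy t =>
    abs_conjKernel_sub_trunc_le hy (x - t)
  have hEP : ∀ y, 0 < y → ∀ t, |E y t| ≤ 2 * y * P y t := by
    intro y hy t
    simp only [hE, hP]
    split_ifs with h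
    · simp; positivity
    · have h1 : (x - t) ^ 2 ≤ y ^ 2 := by
        rw [← sq_abs]; exact pow_le_pow_left₀ (abs_nonneg _) (not_le.mp h).le 2
      have h2 : |t / (t ^ 2 + 1)| ≤ 1 := by
        rw [abs_div, abs_of_pos (by positivity : 0 < t ^ 2 + 1), div_le_one (by positivity)]
        rw [abs_le]; constructor <;> nlinarith
      refine h2.trans ?_
      rw [← mul_div_assoc, le_div_iff₀ (by positivity)]
      nlinarith
  have hPb : ∀ y, 0 < y → ∀ t, |P y t| ≤ _ * (1 / (1 + t ^ 2)) := fun y hy t =>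
    abs_poissonKernel_le hy x t
  have hDb : ∀ y, 0 < y → ∀ t, |D y t| ≤ _ * (1 / (1 + t ^ 2)) := fun y hy t =>
    ((hDP y hy t).trans (le_abs_self _)).trans (hPb y hy t)
  have hEb : ∀ y, 0 < y → ∀ t, |E y t| ≤ (2 * y * _) * (1 / (1 + t ^ 2)) := fun y hy t => by
    rw [mul_assoc]
    exact (hEP y hy t).trans (by gcongr; exact (le_abs_self _).trans (hPb y hy t))
  have hD0 : ∀ y, 0 < y → ∫ t, D y t = 0 := by
    intro y hy
    set d : ℝ → ℝ := fun u => u / (u ^ 2 + y ^ 2) - if y ≤ |u| then 1 / u else 0 with hd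
    have h1 : ∫ t, D y t = ∫ u, d u := integral_sub_left_eq_self d volume x
    have h2 : ∫ u, d u = -∫ u, d u := by
      rw [← integral_neg, ← integral_neg_eq_self]
      congr 1; ext u
      simp only [hd, abs_neg, neg_sq]
      split_ifs
      · ring
      · ring
    linarith
  have key : ∀ y, 0 < y →
      (1 / Real.pi * ∫ t, f t * ((x - t) / ((x - t) ^ 2 + y ^ 2) + t / (t ^ 2 + 1)))
        - truncModifiedHilbert f y x
      = 1 / Real.pi * ((∫ t, (f t - f x) * D y t) + ∫ t, f t * E y t) := by
    intro y hy
    have i1 := integrable_mul_of_le hf (hDm y).aestronglyMeasurable (hDb y hy)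
    have i2 := integrable_mul_of_le hf (hEm y).aestronglyMeasurable (hEb y hy)
    have i3 := integrable_mul_of_le hwc (hDm y).aestronglyMeasurable (hDb y hy)
    have i4 := integrable_mul_conjKernel hf x hy
    have e1 : ∫ t, (f t - f x) * D y t = ∫ t, f t * D y t := by
      simp_rw [sub_mul]
      rw [integral_sub i1 i3, integral_const_mul, hD0 y hy]; ring
    unfold truncModifiedHilbert
    rw [← integral_indicator (hms y), e1, ← integral_add i1 i2, ← mul_sub]
    have e2 : ∀ t, ({t : ℝ | y ≤ |x - t|}.indicator
        (fun t => f t * (1 / (x - t) + t / (t ^ 2 + 1)))) t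
        = f t * ((x - t) / ((x - t) ^ 2 + y ^ 2) + t / (t ^ 2 + 1))
          - (f t * D y t + f t * E y t) := by
      intro t
      simp only [Set.indicator_apply, Set.mem_ofPred_eq, hD, hE]
      split_ifs <;> ring
    simp_rw [e2]
    have i12 : Integrable fun t => f t * D y t + f t * E y t := i1.add i2
    rw [integral_sub i4 i12]
    ring
  have hbound : Tendsto (fun y : ℝ => 1 / Real.pi * ((∫ t, |f t - f x| * P y t)
      + 2 * y * ((∫ t, |f t - f x| * P y t) + |f x| * Real.pi))) (𝓝[>] 0) (𝓝 0) := by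
    have hy : Tendsto (fun y : ℝ => 2 * y) (𝓝[>] 0) (𝓝 0) := by
      have : Tendsto (fun y : ℝ => 2 * y) (𝓝 0) (𝓝 (2 * 0)) := Continuous.tendsto (by fun_prop) 0
      rw [mul_zero] at this
      exact this.mono_left nhdsWithin_le_nhds
    simpa using (hx.add (hy.mul (hx.add_const (|f x| * Real.pi)))).const_mul (1 / Real.pi)
  refine squeeze_zero_norm' ?_ hbound
  filter_upwards [self_mem_nhdsWithin] with y hy
  have hy : 0 < y := hy
  rw [key y hy, norm_mul, Real.norm_of_nonneg (by positivity : 0 ≤ 1 / Real.pi)]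
  have iP := integrable_mul_poissonKernel hw x hy
  gcongr
  refine (norm_add_le _ _).trans (add_le_add ?_ ?_)
  · apply norm_integral_le_of_norm_le iP
    refine ae_of_all _ fun t => ?_
    rw [norm_mul, Real.norm_eq_abs, Real.norm_eq_abs]
    gcongr; exact hDP y hy t
  · have hPi : Integrable (P y) := by
      have h1 : Integrable fun t => (fun _ => (1 : ℝ)) t / (1 + t ^ 2) := by
        simpa using integrable_inv_one_add_sq
      simpa using integrable_mul_poissonKernel h1 x hy
    have e3 : 2 * y * ((∫ t, |f t - f x| * P y t) + |f x| * Real.pi)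
        = ∫ t, 2 * y * (|f t - f x| * P y t + |f x| * P y t) := by
      rw [integral_const_mul, integral_add iP (hPi.const_mul _), integral_const_mul,
        integral_poissonKernel x hy]
    rw [e3]
    apply norm_integral_le_of_norm_le ((iP.add (hPi.const_mul _)).const_mul _)
    refine ae_of_all _ fun t => ?_
    rw [norm_mul, Real.norm_eq_abs, Real.norm_eq_abs]
    have h1 : |f t| ≤ |f t - f x| + |f x| := by
      simpa using abs_add_le (f t - f x) (f x)
    calc |f t| * |E y t| ≤ (|f t - f x| + |f x|) * (2 * y * P y t) := by
          gcongr; exact hEP y hy t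
      _ = 2 * y * (|f t - f x| * P y t + |f x| * P y t) := by ring

/-- The principal value integral exists at points where `f` is Lipschitz. -/
theorem exists_tendsto_truncModifiedHilbert {f : ℝ → ℝ} (hf : Integrable fun t => f t / (1 + t ^ 2))
    {x δ L : ℝ} (hδ : 0 < δ) (hL : ∀ t, |x - t| < δ → |f t - f x| ≤ L * |x - t|) :
    ∃ l, Tendsto (fun ε : ℝ => truncModifiedHilbert f ε x) (𝓝[>] 0) (𝓝 l) := by
  have hL0 : 0 ≤ L := by
    have h := (abs_nonneg _).trans (hL (x - δ / 2) (by
      rw [sub_sub_cancel, abs_of_pos (by positivity)]; linarith))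
    rw [sub_sub_cancel, abs_of_pos (by positivity)] at h
    by_contra hc
    nlinarith
  have hfm := aestronglyMeasurable_of_weighted hf
  have hms : ∀ y : ℝ, MeasurableSet {t : ℝ | y ≤ |x - t|} := fun y =>
    measurableSet_le measurable_const (by fun_prop)
  have hms' : ∀ y : ℝ, MeasurableSet {t : ℝ | |x - t| < y} := fun y =>
    measurableSet_lt (by fun_prop) measurable_const
  have hfin : ∀ y : ℝ, volume {t : ℝ | |x - t| < y} < ⊤ := by
    intro y
    refine (measure_mono ?_).trans_lt (measure_closedBall_lt_top (x := x) (r := y))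
    intro t ht
    rw [Metric.mem_closedBall, Real.dist_eq, abs_sub_comm]
    exact le_of_lt ht
  -- The singular integrand splits into the bounded difference quotient `n` near x, a part `m` that
  -- is integrable without truncation, and f(x)/(x-t) on ε ≤ |x-t| < δ (the function `k` below),
  -- which is odd about x and integrates to zero.
  set n : ℝ → ℝ := {t : ℝ | |x - t| < δ}.indicator fun t => (f t - f x) / (x - t) with hn
  set D : ℝ → ℝ := fun t => (x - t) / ((x - t) ^ 2 + δ ^ 2)
    - if δ ≤ |x - t| then 1 / (x - t) else 0 with hD
  set m : ℝ → ℝ := fun t => f t * ((x - t) / ((x - t) ^ 2 + δ ^ 2) + t / (t ^ 2 + 1) - D t) with hm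
  have hDm : Measurable D := (by fun_prop : Measurable fun t : ℝ => (x - t) / ((x - t) ^ 2 + δ ^ 2)).sub
      (Measurable.ite (hms δ) (by fun_prop) measurable_const)
  have hni : Integrable n := by
    rw [hn, integrable_indicator_iff (hms' δ)]
    apply Measure.integrableOn_of_bounded (M := L) (hfin δ).ne
    · exact ((hfm.sub aestronglyMeasurable_const).mul
        (by fun_prop : Measurable fun t : ℝ => (x - t)⁻¹).aestronglyMeasurable)
    · refine (ae_restrict_iff' (hms' δ)).mpr (ae_of_all _ fun t ht => ?_)
      rw [norm_div, Real.norm_eq_abs, Real.norm_eq_abs]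
      exact div_le_of_le_mul₀ (abs_nonneg _) hL0 (hL t ht)
  have hmi : Integrable m := by
    have h1 := integrable_mul_conjKernel hf x hδ
    have h2 := integrable_mul_of_le hf hDm.aestronglyMeasurable (fun t =>
      ((abs_conjKernel_sub_trunc_le hδ (x - t)).trans (le_abs_self _)).trans
        (abs_poissonKernel_le hδ x t))
    refine (h1.sub h2).congr (ae_of_all _ fun t => ?_)
    simp only [hm, Pi.sub_apply]; ring
  have hlim : Tendsto (fun ε : ℝ => ∫ t in {t : ℝ | ε ≤ |x - t|}, (n t + m t)) (𝓝[>] 0)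
      (𝓝 (∫ t, (n t + m t))) := by
    simp_rw [← integral_indicator (hms _)]
    apply tendsto_integral_filter_of_dominated_convergence (fun t => ‖n t + m t‖)
    · exact Eventually.of_forall fun ε =>
        (hni.add hmi).aestronglyMeasurable.indicator (hms ε)
    · exact Eventually.of_forall fun ε => ae_of_all _ fun t => norm_indicator_le_norm_self _ _
    · exact (hni.add hmi).norm
    · filter_upwards [Measure.ae_ne volume x] with t ht
      apply tendsto_const_nhds.congr'
      have : 0 < |x - t| := abs_pos.mpr (sub_ne_zero.mpr ht.symm)
      filter_upwards [mem_nhdsWithin_of_mem_nhds (Iio_mem_nhds this)] with ε hε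
      have hε' : ε < |x - t| := hε
      rw [Set.indicator_of_mem]
      exact hε'.le
  refine ⟨1 / Real.pi * ∫ t, (n t + m t), ?_⟩
  refine (hlim.const_mul (1 / Real.pi)).congr' ?_
  filter_upwards [self_mem_nhdsWithin] with ε hε
  have hε : 0 < ε := hε
  unfold truncModifiedHilbert
  congr 1
  rw [← integral_indicator (hms _), ← integral_indicator (hms _)]
  set k : ℝ → ℝ := fun u => if ε ≤ |u| ∧ |u| < δ then f x / u else 0 with hk
  have hk0 : ∫ t, k (x - t) = 0 := by
    have h1 : ∫ t, k (x - t) = ∫ u, k u := integral_sub_left_eq_self k volume x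
    have h2 : ∫ u, k u = -∫ u, k u := by
      rw [← integral_neg, ← integral_neg_eq_self]
      congr 1; ext u
      simp only [hk, abs_neg]
      split_ifs
      · ring
      · ring
    linarith
  have hkms : MeasurableSet {t : ℝ | ε ≤ |x - t| ∧ |x - t| < δ} := (hms ε).inter (hms' δ)
  have hki : Integrable fun t => k (x - t) := by
    have e : (fun t => k (x - t)) =
        {t : ℝ | ε ≤ |x - t| ∧ |x - t| < δ}.indicator fun t => f x / (x - t) := by
      ext t; simp only [hk, Set.indicator_apply, Set.mem_ofPred_eq]
    rw [e, integrable_indicator_iff hkms]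
    apply Measure.integrableOn_of_bounded (M := |f x| / ε)
      ((measure_mono fun t ht => ht.2).trans_lt (hfin δ)).ne
    · exact (by fun_prop : Measurable fun t : ℝ => f x / (x - t)).aestronglyMeasurable
    · refine (ae_restrict_iff' hkms).mpr (ae_of_all _ fun t ht => ?_)
      rw [norm_div, Real.norm_eq_abs, Real.norm_eq_abs]
      gcongr
      exact ht.1
  have e2 : ∀ t, ({t : ℝ | ε ≤ |x - t|}.indicator
      (fun t => f t * (1 / (x - t) + t / (t ^ 2 + 1)))) t
      = ({t : ℝ | ε ≤ |x - t|}.indicator (fun t => n t + m t)) t + k (x - t) := by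
    intro t
    simp only [Set.indicator_apply, Set.mem_ofPred_eq, hD, hn, hm, hk]
    by_cases h1 : ε ≤ |x - t| <;> by_cases h2 : |x - t| < δ
    · simp only [h1, h2, not_le.mpr h2, if_true, if_false, and_self]; ring
    · simp only [h1, h2, not_lt.mp h2, if_true, if_false, and_false]; ring
    · simp [h1]
    · simp [h1]
  simp_rw [e2]
  have hnm : Integrable fun t => n t + m t := hni.add hmi
  rw [integral_add (hnm.indicator (hms ε)) hki, hk0, add_zero]

/-! ### The sawtooth reduction of the phase -/

noncomputable section

/-- Reduction of a phase `φ` modulo `π` to `[-π/2, π/2)`. -/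
def sawtooth (φ : ℝ → ℝ) (t : ℝ) : ℝ := φ t - Real.pi * ⌊φ t / Real.pi + 1 / 2⌋

end

section

variable {φ : ℝ → ℝ}

theorem abs_sawtooth_le (φ : ℝ → ℝ) (t : ℝ) : |sawtooth φ t| ≤ Real.pi / 2 := by
  unfold sawtooth
  have h1 := Int.floor_le (φ t / Real.pi + 1 / 2)
  have h2 := Int.lt_floor_add_one (φ t / Real.pi + 1 / 2)
  have hπ := Real.pi_pos
  have h3 : φ t = Real.pi * (φ t / Real.pi) := by field_simp
  rw [abs_le]
  constructor <;> nlinarith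

theorem monotone_floor_phase (hφ : Monotone φ) :
    Monotone fun t => ⌊φ t / Real.pi + 1 / 2⌋ := by
  intro a b hab
  have := Real.pi_pos
  have := hφ hab
  exact Int.floor_le_floor (by gcongr)

theorem measurable_sawtooth (hφ : Monotone φ) : Measurable (sawtooth φ) := by
  have := (monotone_floor_phase hφ).measurable
  unfold sawtooth
  exact hφ.measurable.sub ((measurable_from_top (f := fun n : ℤ => (n : ℝ))).comp this |>.const_mul _)

/-- The subtracted floor is monotone, so jumps only go down and the upper half of the Lipschitz
condition survives. This one-sided bound is what controls the growth of the multiplier. -/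
theorem sawtooth_sub_le (hφ : Monotone φ) {L : ℝ} (hL : ∀ a b, |φ a - φ b| ≤ L * |a - b|) {x t : ℝ}
    (hxt : x ≤ t) : sawtooth φ t - sawtooth φ x ≤ L * (t - x) := by
  have h1 : (⌊φ x / Real.pi + 1 / 2⌋ : ℝ) ≤ ⌊φ t / Real.pi + 1 / 2⌋ := by
    exact_mod_cast monotone_floor_phase hφ hxt
  have h2 := (le_abs_self _).trans (hL t x)
  rw [abs_of_nonneg (sub_nonneg.mpr hxt)] at h2
  unfold sawtooth
  nlinarith [Real.pi_pos]

theorem sawtooth_eq_self {t : ℝ} (ht : |φ t| < Real.pi / 2) : sawtooth φ t = φ t := by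
  have hπ := Real.pi_pos
  rw [abs_lt] at ht
  have : ⌊φ t / Real.pi + 1 / 2⌋ = 0 := by
    rw [Int.floor_eq_zero_iff]
    constructor
    · have : -(1 / 2) ≤ φ t / Real.pi := by rw [le_div_iff₀ hπ]; linarith
      linarith
    · have : φ t / Real.pi < 1 / 2 := by rw [div_lt_iff₀ hπ]; linarith
      linarith
  unfold sawtooth
  rw [this]; simp

theorem integrable_sawtooth_div (hφ : Monotone φ) :
    Integrable fun t => sawtooth φ t / (1 + t ^ 2) := by
  apply (integrable_inv_one_add_sq.const_mul (Real.pi / 2)).mono'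
  · exact ((measurable_sawtooth hφ).div (by fun_prop)).aestronglyMeasurable
  · refine ae_of_all _ fun t => ?_
    rw [norm_div, Real.norm_of_nonneg (by positivity : 0 ≤ 1 + t ^ 2), div_eq_mul_inv]
    gcongr
    exact abs_sawtooth_le φ t

/-- A monotone integer-valued function has countably many discontinuities and is locally constant
elsewhere. Off that null set the sawtooth satisfies a Lipschitz bound at the point, and the
principal value exists. -/
theorem exists_isModifiedHilbertTransform_sawtooth (hφ : Monotone φ) {L : ℝ}
    (hL : ∀ a b, |φ a - φ b| ≤ L * |a - b|) :
    ∃ k : ℝ → ℝ, IsModifiedHilbertTransform (sawtooth φ) k := by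
  have h : ∀ᵐ x : ℝ, ∃ l, Tendsto (fun ε : ℝ => truncModifiedHilbert (sawtooth φ) ε x)
      (𝓝[>] 0) (𝓝 l) := by
    filter_upwards [(monotone_floor_phase hφ).countable_not_continuousAt.ae_notMem volume] with x hx
    have hc : ContinuousAt (fun t => ⌊φ t / Real.pi + 1 / 2⌋) x := by simpa using hx
    have hev : ∀ᶠ t in 𝓝 x, ⌊φ t / Real.pi + 1 / 2⌋ = ⌊φ x / Real.pi + 1 / 2⌋ :=
      hc.tendsto.eventually (p := fun n : ℤ => n = ⌊φ x / Real.pi + 1 / 2⌋)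
        (by rw [nhds_discrete]; exact eventually_pure.mpr rfl)
    obtain ⟨δ, hδ, hball⟩ := Metric.eventually_nhds_iff.mp hev
    refine exists_tendsto_truncModifiedHilbert (integrable_sawtooth_div hφ) hδ (L := L) ?_
    intro t ht
    have := hball (y := t) (by rwa [Real.dist_eq, abs_sub_comm])
    unfold sawtooth
    rw [this, abs_sub_comm x t]
    simpa using hL t x
  choose! k hk using fun x (hx : ∃ l, Tendsto (fun ε : ℝ => truncModifiedHilbert (sawtooth φ) ε x)
      (𝓝[>] 0) (𝓝 l)) => hx
  exact ⟨k, h.mono fun x hx => hk x hx⟩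

end

/-! ### Bounds for the conjugate Poisson integral of the sawtooth -/

theorem integrable_indicator_inv_abs {r A : ℝ} (hr : 0 < r) :
    Integrable fun u : ℝ => (Set.Icc r A).indicator (fun v => 1 / v) |u| := by
  have hms : MeasurableSet {u : ℝ | |u| ∈ Set.Icc r A} :=
    measurableSet_Icc.preimage (by fun_prop : Measurable fun u : ℝ => |u|)
  have e : (fun u : ℝ => (Set.Icc r A).indicator (fun v => 1 / v) |u|)
      = {u : ℝ | |u| ∈ Set.Icc r A}.indicator fun u => 1 / |u| := by
    ext u
    simp only [Set.indicator_apply, Set.mem_ofPred_eq]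
  rw [e, integrable_indicator_iff hms]
  apply Measure.integrableOn_of_bounded (M := 1 / r)
  · refine ((measure_mono (t := Metric.closedBall 0 A) ?_).trans_lt
      (measure_closedBall_lt_top)).ne
    intro u hu
    simpa using hu.2
  · exact (by fun_prop : Measurable fun u : ℝ => 1 / |u|).aestronglyMeasurable
  · refine (ae_restrict_iff' hms).mpr (ae_of_all _ fun u hu => ?_)
    rw [norm_div, norm_one, Real.norm_eq_abs, abs_abs]
    gcongr
    exact hu.1

theorem integral_indicator_inv_abs {r A : ℝ} (hr : 0 < r) (hA : r ≤ A) :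
    ∫ u : ℝ, (Set.Icc r A).indicator (fun v => 1 / v) |u| = 2 * Real.log (A / r) := by
  rw [integral_comp_abs (f := (Set.Icc r A).indicator fun v => 1 / v),
    setIntegral_indicator measurableSet_Icc,
    Set.inter_eq_right.mpr (show Set.Icc r A ⊆ Set.Ioi 0 from fun v hv => hr.trans_le hv.1),
    integral_Icc_eq_integral_Ioc,
    ← intervalIntegral.integral_of_le hA, integral_one_div_of_pos hr (hr.trans_le hA)]

theorem integrable_indicator_inv_sq {T : ℝ} (hT : 1 ≤ T) :
    Integrable fun u : ℝ => (Set.Ioi T).indicator (fun v => 1 / v ^ 2) |u| := by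
  have hms : MeasurableSet {u : ℝ | |u| ∈ Set.Ioi T} :=
    measurableSet_Ioi.preimage (by fun_prop : Measurable fun u : ℝ => |u|)
  have e : (fun u : ℝ => (Set.Ioi T).indicator (fun v => 1 / v ^ 2) |u|)
      = {u : ℝ | |u| ∈ Set.Ioi T}.indicator fun u => 1 / u ^ 2 := by
    ext u
    simp only [Set.indicator_apply, Set.mem_ofPred_eq, sq_abs]
  rw [e, integrable_indicator_iff hms]
  refine (integrable_inv_one_add_sq.const_mul 2).integrableOn.mono'
    (by fun_prop : Measurable fun u : ℝ => 1 / u ^ 2).aestronglyMeasurable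
    ((ae_restrict_iff' hms).mpr (ae_of_all _ fun u hu => ?_))
  have h1 : 1 ≤ u ^ 2 := by
    rw [← sq_abs]
    have : T < |u| := hu
    nlinarith
  rw [Real.norm_of_nonneg (by positivity), ← div_eq_mul_inv, div_le_div_iff₀ (by positivity)
    (by positivity)]
  linarith

theorem integral_indicator_inv_sq {T : ℝ} (hT : 0 < T) :
    ∫ u : ℝ, (Set.Ioi T).indicator (fun v => 1 / v ^ 2) |u| = 2 / T := by
  rw [integral_comp_abs (f := (Set.Ioi T).indicator fun v => 1 / v ^ 2),
    setIntegral_indicator measurableSet_Ioi,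
    Set.inter_eq_right.mpr (show Set.Ioi T ⊆ Set.Ioi 0 from fun v hv => hT.trans hv)]
  have e : ∀ v ∈ Set.Ioi T, 1 / v ^ 2 = v ^ (-2 : ℝ) := by
    intro v hv
    rw [Real.rpow_neg (hT.trans hv).le, one_div]
    norm_cast
  rw [setIntegral_congr_fun measurableSet_Ioi e, integral_Ioi_rpow_of_lt (by norm_num) hT]
  norm_num
  rw [Real.rpow_neg hT.le, Real.rpow_one]
  field_simp

/-- Pointwise majorant of the far part of the conjugate Poisson kernel. -/
theorem abs_far_kernel_le {x y r w T : ℝ} (hy : 0 < y) (hr : 1 ≤ r) (hw : w = |x| + y)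
    (hT : T = 2 * w + 2 * r) (t : ℝ) :
    |(if r ≤ |t - x| then (t - x) / ((t - x) ^ 2 + y ^ 2) else 0)
        - (if r ≤ |t| then t / (t ^ 2 + 1) else 0)|
      ≤ (Set.Icc r (T + w)).indicator (fun v => 1 / v) |t - x|
        + (Set.Icc r T).indicator (fun v => 1 / v) |t|
        + (2 * w + 1) * (Set.Ioi T).indicator (fun v => 1 / v ^ 2) |t| := by
  have hx0 := abs_nonneg x
  have hw0 : 0 < w := by rw [hw]; positivity
  have htx : |t - x| ≤ |t| + |x| := abs_sub t x
  have htx' : |t| - |x| ≤ |t - x| := abs_sub_abs_le_abs_sub t x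
  have hA : ∀ u : ℝ, |u / (u ^ 2 + y ^ 2)| ≤ 1 / |u| := by
    intro u
    rcases eq_or_ne u 0 with rfl | hu
    · simp
    rw [abs_div, abs_of_pos (by positivity : 0 < u ^ 2 + y ^ 2), div_le_div_iff₀ (by positivity)
      (abs_pos.mpr hu), ← sq, sq_abs]
    nlinarith [sq_nonneg y]
  have hB : |t / (t ^ 2 + 1)| ≤ 1 / |t| := by
    rcases eq_or_ne t 0 with rfl | hu
    · simp
    rw [abs_div, abs_of_pos (by positivity : 0 < t ^ 2 + 1), div_le_div_iff₀ (by positivity)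
      (abs_pos.mpr hu), ← sq, sq_abs]
    nlinarith
  rcases le_or_gt |t| T with h | h
  · have h3 : (Set.Ioi T).indicator (fun v : ℝ => 1 / v ^ 2) |t| = 0 :=
      Set.indicator_of_notMem (by simpa using h) _
    rw [h3, mul_zero, add_zero]
    refine (abs_sub _ _).trans (add_le_add ?_ ?_)
    · split_ifs with h1
      · rw [Set.indicator_of_mem (s := Set.Icc r (T + w)) ⟨h1, by linarith⟩]
        exact hA _
      · simp only [abs_zero]
        exact Set.indicator_apply_nonneg fun _ => by positivity
    · split_ifs with h1
      · rw [Set.indicator_of_mem (s := Set.Icc r T) ⟨h1, h⟩]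
        exact hB
      · simp only [abs_zero]
        exact Set.indicator_apply_nonneg fun _ => by positivity
  -- Beyond T the point t is at least twice as far from 0 as x is, so |t-x| ≥ |t|/2. Comparing each
  -- kernel with 1/t cancels the leading terms and leaves O(w/t²).
  · have ht1 : 1 ≤ |t| := by linarith
    have hm1 : |t| / 2 ≤ |t - x| := by linarith
    have hm2 : r ≤ |t - x| := by linarith
    have hm3 : y ≤ |t - x| := by linarith
    have hu0 : 0 < |t - x| := by linarith
    have ht0 : t ≠ 0 := by rintro rfl; simp at ht1; linarith
    rw [if_pos hm2, if_pos (by linarith), Set.indicator_of_mem (s := Set.Ioi T) h]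
    have hnn : 0 ≤ (Set.Icc r (T + w)).indicator (fun v => 1 / v) |t - x|
        + (Set.Icc r T).indicator (fun v => 1 / v) |t| :=
      add_nonneg (Set.indicator_apply_nonneg fun _ => by positivity)
        (Set.indicator_apply_nonneg fun _ => by positivity)
    refine le_trans ?_ (le_add_of_nonneg_left hnn)
    have hp : 0 < (t - x) ^ 2 + y ^ 2 := by positivity
    have e : (t - x) / ((t - x) ^ 2 + y ^ 2) - t / (t ^ 2 + 1)
        = (x * (t - x) - y ^ 2) / (t * ((t - x) ^ 2 + y ^ 2)) + 1 / (t * (t ^ 2 + 1)) := by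
      field_simp
      ring
    rw [e]
    have b1 : |(x * (t - x) - y ^ 2) / (t * ((t - x) ^ 2 + y ^ 2))| ≤ 2 * w * (1 / |t| ^ 2) := by
      have h1 : |x * (t - x) - y ^ 2| ≤ w * |t - x| := by
        refine (abs_sub _ _).trans ?_
        rw [abs_mul, abs_of_pos (by positivity : 0 < y ^ 2), hw]
        nlinarith
      rw [abs_div, abs_mul, abs_of_pos hp, mul_one_div, div_le_div_iff₀ (by positivity)
        (by positivity)]
      have h2 : |t - x| ^ 2 ≤ (t - x) ^ 2 + y ^ 2 := by rw [sq_abs]; nlinarith [sq_nonneg y]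
      calc |x * (t - x) - y ^ 2| * |t| ^ 2 ≤ w * |t - x| * |t| ^ 2 := by gcongr
        _ ≤ w * |t - x| * (|t| * (2 * |t - x|)) := by
            rw [sq]; gcongr; linarith
        _ = 2 * w * (|t| * |t - x| ^ 2) := by ring
        _ ≤ _ := by gcongr
    have b2 : |1 / (t * (t ^ 2 + 1))| ≤ 1 / |t| ^ 2 := by
      rw [abs_div, abs_one, abs_mul, abs_of_pos (by positivity : 0 < t ^ 2 + 1)]
      gcongr
      rw [sq_abs]
      nlinarith [sq_nonneg t]
    calc _ ≤ _ := abs_add_le _ _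
      _ ≤ 2 * w * (1 / |t| ^ 2) + 1 / |t| ^ 2 := add_le_add b1 b2
      _ = _ := by ring

theorem integral_far_majorant {x y r w T : ℝ} (hy : 0 < y) (hr : 1 ≤ r) (hw : w = |x| + y)
    (hT : T = 2 * w + 2 * r) :
    (Integrable fun t => (Set.Icc r (T + w)).indicator (fun v => 1 / v) |t - x|
        + (Set.Icc r T).indicator (fun v => 1 / v) |t|
        + (2 * w + 1) * (Set.Ioi T).indicator (fun v => 1 / v ^ 2) |t|) ∧
    ∫ t, ((Set.Icc r (T + w)).indicator (fun v => 1 / v) |t - x|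
        + (Set.Icc r T).indicator (fun v => 1 / v) |t|
        + (2 * w + 1) * (Set.Ioi T).indicator (fun v => 1 / v ^ 2) |t|)
      ≤ 2 * Real.log ((T + w) / r) + 2 * Real.log (T / r) + 2 := by
  have hx0 := abs_nonneg x
  have hw0 : 0 < w := by rw [hw]; positivity
  have hr0 : 0 < r := by linarith
  have i1 : Integrable fun t => (Set.Icc r (T + w)).indicator (fun v => 1 / v) |t - x| :=
    (integrable_indicator_inv_abs hr0).comp_sub_right x
  have i2 : Integrable fun t => (Set.Icc r T).indicator (fun v => 1 / v) |t| :=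
    integrable_indicator_inv_abs hr0
  have i3 : Integrable fun t => (2 * w + 1) * (Set.Ioi T).indicator (fun v => 1 / v ^ 2) |t| :=
    (integrable_indicator_inv_sq (by linarith)).const_mul _
  have i12 : Integrable fun t => (Set.Icc r (T + w)).indicator (fun v => 1 / v) |t - x|
      + (Set.Icc r T).indicator (fun v => 1 / v) |t| := i1.add i2
  refine ⟨i12.add i3, ?_⟩
  rw [integral_add i12 i3, integral_add i1 i2, integral_const_mul,
    integral_sub_right_eq_self (fun u => (Set.Icc r (T + w)).indicator (fun v => 1 / v) |u|) x,
    integral_indicator_inv_abs hr0 (by linarith), integral_indicator_inv_abs hr0 (by linarith),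
    integral_indicator_inv_sq (by linarith)]
  have : (2 * w + 1) * (2 / T) ≤ 2 := by
    rw [← mul_div_assoc, div_le_iff₀ (by linarith)]
    linarith
  linarith

theorem integrable_of_bounded_of_ball {g : ℝ → ℝ} (hg : AEStronglyMeasurable g) {x r B : ℝ}
    (hB : ∀ t, |g t| ≤ B) (h0 : ∀ t, r ≤ |t - x| → g t = 0) : Integrable g := by
  have hfin : volume (Metric.ball x r) ≠ ⊤ := measure_ball_lt_top.ne
  have h1 : IntegrableOn g (Metric.ball x r) :=
    Measure.integrableOn_of_bounded (M := B) hfin hg (ae_of_all _ hB)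
  refine (integrableOn_iff_integrable_of_support_subset ?_).mp h1
  intro t ht
  by_contra hc
  rw [Metric.mem_ball, Real.dist_eq, not_lt] at hc
  exact ht (h0 t hc)

theorem integral_indicator_ball_const (x L : ℝ) {r : ℝ} (hr : 0 ≤ r) :
    ∫ t, (Metric.ball x r).indicator (fun _ => L) t = 2 * r * L := by
  rw [integral_indicator Metric.isOpen_ball.measurableSet, setIntegral_const, measureReal_def,
    Real.volume_ball, ENNReal.toReal_ofReal (by linarith), smul_eq_mul]

theorem integrable_indicator_ball_const (x r L : ℝ) :
    Integrable fun t => (Metric.ball x r).indicator (fun _ : ℝ => L) t := by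
  rw [integrable_indicator_iff Metric.isOpen_ball.measurableSet]
  exact integrableOn_const measure_ball_lt_top.ne

noncomputable section

/-- The kernel `u/(u²+y²)` restricted to `|u| < r`. -/
def nearKernel (r y u : ℝ) : ℝ := if r ≤ |u| then 0 else u / (u ^ 2 + y ^ 2)

/-- The kernel `u/(u²+y²)` restricted to `|u| ≥ r`. -/
def farKernel (r y u : ℝ) : ℝ := if r ≤ |u| then u / (u ^ 2 + y ^ 2) else 0

end

theorem nearKernel_add_farKernel (r y u : ℝ) :
    nearKernel r y u + farKernel r y u = u / (u ^ 2 + y ^ 2) := by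
  unfold nearKernel farKernel; split_ifs <;> simp

theorem measurable_nearKernel (r y : ℝ) : Measurable (nearKernel r y) :=
  Measurable.ite (measurableSet_le measurable_const (by fun_prop)) measurable_const (by fun_prop)

theorem measurable_farKernel (r y : ℝ) : Measurable (farKernel r y) :=
  Measurable.ite (measurableSet_le measurable_const (by fun_prop)) (by fun_prop) measurable_const

theorem nearKernel_neg (r y u : ℝ) : nearKernel r y (-u) = -nearKernel r y u := by
  unfold nearKernel; simp only [abs_neg, neg_sq]; split_ifs <;> ring

theorem abs_nearKernel_le {y : ℝ} (hy : 0 < y) (r u : ℝ) : |nearKernel r y u| ≤ 1 / y := by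
  unfold nearKernel
  split_ifs
  · simp; positivity
  · rw [abs_div, abs_of_pos (by positivity : 0 < u ^ 2 + y ^ 2), div_le_div_iff₀ (by positivity) hy,
      ← sq_abs u]
    nlinarith [sq_nonneg (|u| - y), abs_nonneg u]

theorem integrable_nearKernel (x r : ℝ) {y : ℝ} (hy : 0 < y) :
    Integrable fun t => nearKernel r y (t - x) :=
  integrable_of_bounded_of_ball (x := x) (r := r)
    ((measurable_nearKernel r y).comp (by fun_prop)).aestronglyMeasurable
    (fun t => abs_nearKernel_le hy r (t - x)) fun t ht => if_pos ht

theorem integral_nearKernel (x r y : ℝ) : ∫ t, nearKernel r y (t - x) = 0 := by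
  have h1 : ∫ t, nearKernel r y (t - x) = ∫ u, nearKernel r y u :=
    integral_sub_right_eq_self (nearKernel r y) x
  have h2 : ∫ u, nearKernel r y u = -∫ u, nearKernel r y u := by
    rw [← integral_neg, ← integral_neg_eq_self]
    congr 1; ext u
    rw [nearKernel_neg]
  linarith

theorem integrable_mul_nearKernel {s : ℝ → ℝ} (hs : Measurable s) {B : ℝ} (hB : ∀ t, |s t| ≤ B)
    (x r : ℝ) {y : ℝ} (hy : 0 < y) : Integrable fun t => s t * nearKernel r y (t - x) := by
  refine ((integrable_nearKernel x r hy).norm.const_mul B).mono'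
    (hs.mul ((measurable_nearKernel r y).comp (by fun_prop))).aestronglyMeasurable
    (ae_of_all _ fun t => ?_)
  rw [norm_mul]
  gcongr
  exact hB t

/-- The kernel is odd, so s(x) may be subtracted for free. It also has the sign of t - x, so the
one-sided condition bounds the integrand by L·u²/(u²+y²) ≤ L on an interval of length 2r. -/
theorem integral_mul_nearKernel_le {s : ℝ → ℝ} (hs : Measurable s) {B : ℝ} (hB : ∀ t, |s t| ≤ B)
    {x r y L : ℝ} (hr : 0 ≤ r) (hy : 0 < y) (hL0 : 0 ≤ L)
    (hL : ∀ t, |t - x| < r → (s t - s x) * (t - x) ≤ L * (t - x) ^ 2) :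
    ∫ t, s t * nearKernel r y (t - x) ≤ 2 * r * L := by
  have i1 := integrable_mul_nearKernel hs hB x r hy
  have i2 := (integrable_nearKernel x r hy).const_mul (s x)
  have e : ∫ t, s t * nearKernel r y (t - x)
      = ∫ t, (s t * nearKernel r y (t - x) - s x * nearKernel r y (t - x)) := by
    rw [integral_sub i1 i2, integral_const_mul, integral_nearKernel, mul_zero, sub_zero]
  rw [e, ← integral_indicator_ball_const x L hr]
  refine integral_mono (i1.sub i2) (integrable_indicator_ball_const x r L) fun t => ?_
  simp only [nearKernel]
  split_ifs with h
  · simp only [mul_zero, sub_zero]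
    exact Set.indicator_nonneg (fun _ _ => hL0) _
  · rw [Set.indicator_of_mem (by rw [Metric.mem_ball, Real.dist_eq]; exact not_le.mp h),
      ← sub_mul, ← mul_div_assoc, div_le_iff₀ (by positivity)]
    nlinarith [hL t (not_le.mp h), mul_nonneg hL0 (sq_nonneg y)]

/-- Splitting of the conjugate Poisson integral of a bounded function that is small near `0`. -/
theorem abs_conjPoissonIntegral_add_near_le {s : ℝ → ℝ} (hs : Measurable s) {x y r w T : ℝ}
    (hB : ∀ t, |s t| ≤ Real.pi / 2) (hy : 0 < y) (hr : 1 ≤ r) (hw : w = |x| + y)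
    (hT : T = 2 * w + 2 * r) (h0 : ∀ t, |t| < r → |s t| ≤ Real.pi / (4 * r) * |t|) :
    |(∫ t, s t * ((x - t) / ((x - t) ^ 2 + y ^ 2) + t / (t ^ 2 + 1)))
        + ∫ t, s t * nearKernel r y (t - x)|
      ≤ Real.pi * (Real.log ((T + w) / r) + Real.log (T / r) + 2) := by
  have hπ := Real.pi_pos
  have hr0 : 0 < r := by linarith
  obtain ⟨iM, hM⟩ := integral_far_majorant hy hr hw hT
  set M : ℝ → ℝ := fun t => (Set.Icc r (T + w)).indicator (fun v => 1 / v) |t - x|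
        + (Set.Icc r T).indicator (fun v => 1 / v) |t|
        + (2 * w + 1) * (Set.Ioi T).indicator (fun v => 1 / v ^ 2) |t| with hMdef
  have i1 := integrable_mul_nearKernel hs hB x r hy
  have i2 : Integrable fun t => s t * nearKernel r 1 t := by
    simpa using integrable_mul_nearKernel hs hB 0 r one_pos
  have hfar : ∀ t, |s t * (farKernel r y (t - x) - farKernel r 1 t)| ≤ Real.pi / 2 * M t := by
    intro t
    rw [abs_mul]
    refine mul_le_mul (hB t) ?_ (abs_nonneg _) (by positivity)
    have := abs_far_kernel_le hy hr hw hT t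
    simpa only [farKernel, one_pow] using this
  have i3 : Integrable fun t => s t * (farKernel r y (t - x) - farKernel r 1 t) :=
    (iM.const_mul (Real.pi / 2)).mono' (hs.mul (((measurable_farKernel r y).comp
      (by fun_prop)).sub (measurable_farKernel r 1))).aestronglyMeasurable (ae_of_all _ hfar)
  -- The compensating term t/(t²+1) is the same kernel with centre 0 and height 1. Cutting both
  -- kernels at radius r leaves two near parts and a difference of far parts, which is integrable.
  have e : ∀ t, s t * ((x - t) / ((x - t) ^ 2 + y ^ 2) + t / (t ^ 2 + 1))
      = -(s t * nearKernel r y (t - x)) + s t * nearKernel r 1 t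
        - s t * (farKernel r y (t - x) - farKernel r 1 t) := by
    intro t
    have e1 := nearKernel_add_farKernel r y (t - x)
    have e2 := nearKernel_add_farKernel r 1 t
    rw [one_pow] at e2
    rw [← e2, show (x - t) / ((x - t) ^ 2 + y ^ 2) = -((t - x) / ((t - x) ^ 2 + y ^ 2)) by
      rw [← neg_div, neg_sub, ← neg_sub t x, neg_sq, neg_sub], ← e1]
    ring
  simp_rw [e]
  have i1' : Integrable fun t => -(s t * nearKernel r y (t - x)) := i1.neg
  have i12 : Integrable fun t => -(s t * nearKernel r y (t - x)) + s t * nearKernel r 1 t :=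
    i1'.add i2
  rw [integral_sub i12 i3, integral_add i1' i2, integral_neg]
  have b2 : |∫ t, s t * nearKernel r 1 t| ≤ 2 * r * (Real.pi / (4 * r)) := by
    rw [← integral_indicator_ball_const 0 (Real.pi / (4 * r)) hr0.le, ← Real.norm_eq_abs]
    refine norm_integral_le_of_norm_le (integrable_indicator_ball_const 0 r _)
      (ae_of_all _ fun t => ?_)
    rw [Real.norm_eq_abs, abs_mul]
    by_cases h : r ≤ |t|
    · rw [nearKernel, if_pos h, abs_zero, mul_zero]
      exact Set.indicator_nonneg (fun _ _ => by positivity) _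
    · rw [nearKernel, if_neg h, Set.indicator_of_mem (by simpa using h)]
      have hle : |t| * |t / (t ^ 2 + 1 ^ 2)| ≤ 1 := by
        rw [abs_div, abs_of_pos (by positivity : 0 < t ^ 2 + 1 ^ 2), ← mul_div_assoc,
          div_le_one (by positivity), ← sq, sq_abs]
        linarith
      calc |s t| * |t / (t ^ 2 + 1 ^ 2)|
          ≤ Real.pi / (4 * r) * |t| * |t / (t ^ 2 + 1 ^ 2)| := by
            gcongr; exact h0 t (not_le.mp h)
        _ = Real.pi / (4 * r) * (|t| * |t / (t ^ 2 + 1 ^ 2)|) := by ring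
        _ ≤ Real.pi / (4 * r) * 1 := by gcongr
        _ = _ := mul_one _
  have b3 : |∫ t, s t * (farKernel r y (t - x) - farKernel r 1 t)|
      ≤ Real.pi / 2 * (2 * Real.log ((T + w) / r) + 2 * Real.log (T / r) + 2) := by
    rw [← Real.norm_eq_abs]
    refine (norm_integral_le_of_norm_le (iM.const_mul (Real.pi / 2)) (ae_of_all _ hfar)).trans ?_
    rw [integral_const_mul]
    gcongr
  have e4 : 2 * r * (Real.pi / (4 * r)) = Real.pi / 2 := by field_simp; norm_num
  rw [e4] at b2
  rw [abs_le] at b2 b3 ⊢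
  constructor <;> nlinarith [b2.1, b2.2, b3.1, b3.2]

theorem norm_exp_I_mul_analyticExtension {s : ℝ → ℝ} (hs : Integrable fun t => s t / (1 + t ^ 2))
    (x : ℝ) {y : ℝ} (hy : 0 < y) :
    ‖Complex.exp (Complex.I * analyticExtension s (x + y * Complex.I))‖ =
      Real.exp (-(1 / Real.pi *
        ∫ t, s t * ((x - t) / ((x - t) ^ 2 + y ^ 2) + t / (t ^ 2 + 1)))) := by
  rw [Complex.norm_exp, analyticExtension_add_mul_I hs x hy]
  congr 1
  simp

theorem exp_five_halves_le : Real.exp (5 / 2) ≤ 13 := by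
  have h := Real.exp_one_lt_d9
  have h1 : Real.exp (5 / 2) ^ 2 = Real.exp 1 ^ 5 := by
    rw [← Real.exp_nat_mul, ← Real.exp_nat_mul]; norm_num
  have h2 : Real.exp 1 ^ 5 ≤ 2.7182818286 ^ 5 := by
    gcongr
  have h3 : Real.exp (5 / 2) ^ 2 ≤ 13 ^ 2 := by rw [h1]; refine h2.trans ?_; norm_num
  exact (pow_le_pow_iff_left₀ (Real.exp_pos _).le (by norm_num) two_ne_zero).mp h3

section

variable {φ : ℝ → ℝ} {r : ℝ}

/-- On |t| < 2r the phase stays below π/2 in modulus, so no jump has occurred yet and the sawtooth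
is the phase itself. -/
theorem abs_sawtooth_sub_le (hr : 0 < r) (h0 : φ 0 = 0)
    (hL : ∀ a b, |φ a - φ b| ≤ Real.pi / (4 * r) * |a - b|) {t u : ℝ} (ht : |t| < 2 * r)
    (hu : |u| < 2 * r) :
    |sawtooth φ t - sawtooth φ u| ≤ Real.pi / (4 * r) * |t - u| := by
  have hφ : ∀ v, |v| < 2 * r → sawtooth φ v = φ v := by
    intro v hv
    apply sawtooth_eq_self
    have := hL v 0
    rw [h0, sub_zero, sub_zero] at this
    refine this.trans_lt ?_
    calc Real.pi / (4 * r) * |v| < Real.pi / (4 * r) * (2 * r) := by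
          have := Real.pi_pos
          gcongr
      _ = Real.pi / 2 := by field_simp; norm_num
  rw [hφ t ht, hφ u hu]
  exact hL t u

theorem abs_sawtooth_le_of_abs_lt (hr : 0 < r) (h0 : φ 0 = 0)
    (hL : ∀ a b, |φ a - φ b| ≤ Real.pi / (4 * r) * |a - b|) {t : ℝ} (ht : |t| < 2 * r) :
    |sawtooth φ t| ≤ Real.pi / (4 * r) * |t| := by
  have := abs_sawtooth_sub_le hr h0 hL ht (u := 0) (by simpa using hr)
  have e : sawtooth φ 0 = 0 := by
    rw [sawtooth_eq_self (by rw [h0, abs_zero]; have := Real.pi_pos; positivity), h0]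
  simpa [e] using this

/-- The modulus is exp(-J/π), so only a lower bound on J is needed, and this uses the one-sided
Lipschitz bound alone; it therefore holds at every x, across jumps. The near part contributes 1/2
and the splitting 2 to the exponent, whence exp(5/2) ≤ 13, while the two logarithms become the two
linear factors. -/
theorem norm_exp_sawtooth_le (hφ : Monotone φ) (hr : 1 ≤ r) (h0 : φ 0 = 0)
    (hL : ∀ a b, |φ a - φ b| ≤ Real.pi / (4 * r) * |a - b|) (x : ℝ) {y : ℝ} (hy : 0 < y) :
    ‖Complex.exp (Complex.I * analyticExtension (sawtooth φ) (x + y * Complex.I))‖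
      ≤ 13 * ((2 + 3 * ((|x| + y) / r)) * (2 + 2 * ((|x| + y) / r))) := by
  have hπ := Real.pi_pos
  have hr0 : 0 < r := by linarith
  have hx0 := abs_nonneg x
  have hm := measurable_sawtooth hφ
  have hmain := abs_conjPoissonIntegral_add_near_le hm (abs_sawtooth_le φ) hy hr rfl rfl
    (x := x) (fun t ht => abs_sawtooth_le_of_abs_lt hr0 h0 hL (by linarith))
  have hloc := integral_mul_nearKernel_le hm (abs_sawtooth_le φ) (x := x) (y := y)
    (L := Real.pi / (4 * r)) hr0.le hy (by positivity) (fun t _ => by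
      rcases le_total x t with h | h
      · have := sawtooth_sub_le hφ hL h
        nlinarith [sub_nonneg.mpr h]
      · have := sawtooth_sub_le hφ hL h
        nlinarith [sub_nonneg.mpr h])
  have e4 : 2 * r * (Real.pi / (4 * r)) = Real.pi / 2 := by field_simp; norm_num
  rw [e4] at hloc
  rw [norm_exp_I_mul_analyticExtension (integrable_sawtooth_div hφ) x hy]
  set J := ∫ t, sawtooth φ t * ((x - t) / ((x - t) ^ 2 + y ^ 2) + t / (t ^ 2 + 1)) with hJ
  set w := |x| + y with hw
  have hw0 : 0 < w := by positivity
  have p1 : 0 < (2 * w + 2 * r + w) / r := by positivity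
  have p2 : 0 < (2 * w + 2 * r) / r := by positivity
  have hJle : -(1 / Real.pi * J) ≤ 5 / 2 + (Real.log ((2 * w + 2 * r + w) / r)
      + Real.log ((2 * w + 2 * r) / r)) := by
    have h1 := (abs_le.mp hmain).1
    rw [one_div, ← mul_neg, inv_mul_le_iff₀ hπ]
    nlinarith
  calc Real.exp (-(1 / Real.pi * J)) ≤ _ := Real.exp_le_exp.mpr hJle
    _ = Real.exp (5 / 2) * (((2 * w + 2 * r + w) / r) * ((2 * w + 2 * r) / r)) := by
        rw [Real.exp_add, Real.exp_add, Real.exp_log p1, Real.exp_log p2]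
    _ ≤ 13 * (((2 * w + 2 * r + w) / r) * ((2 * w + 2 * r) / r)) := by
        gcongr; exact exp_five_halves_le
    _ = _ := by
        congr 2 <;> field_simp <;> ring

/-- For |x| ≤ 1 the window |t - x| < r lies inside the jump-free interval |t| < 2r, so the two-sided
Lipschitz bound is available and J is bounded above as well. The constant is 13·5·4 = 260. -/
theorem le_norm_exp_sawtooth (hφ : Monotone φ) (hr : 2 ≤ r) (h0 : φ 0 = 0)
    (hL : ∀ a b, |φ a - φ b| ≤ Real.pi / (4 * r) * |a - b|) {x y : ℝ} (hx : |x| ≤ 1) (hy : 0 < y)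
    (hy1 : y ≤ 1) :
    1 / 260 ≤ ‖Complex.exp (Complex.I * analyticExtension (sawtooth φ) (x + y * Complex.I))‖ := by
  have hπ := Real.pi_pos
  have hr0 : 0 < r := by linarith
  have hx0 := abs_nonneg x
  have hm := measurable_sawtooth hφ
  have hmain := abs_conjPoissonIntegral_add_near_le hm (abs_sawtooth_le φ) hy (by linarith : 1 ≤ r)
    rfl rfl (x := x) (fun t ht => abs_sawtooth_le_of_abs_lt hr0 h0 hL (by linarith))
  have hloc := integral_mul_nearKernel_le (s := fun t => -sawtooth φ t) hm.neg
    (B := Real.pi / 2) (fun t => by rw [abs_neg]; exact abs_sawtooth_le φ t) (x := x) (y := y)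
    (L := Real.pi / (4 * r)) hr0.le hy (by positivity) (fun t ht => by
      have h1 : |t| < 2 * r := by
        have := abs_sub_abs_le_abs_sub t x
        linarith
      have h2 := abs_sawtooth_sub_le hr0 h0 hL h1 (u := x) (by linarith)
      calc (-sawtooth φ t - -sawtooth φ x) * (t - x)
          ≤ |(-sawtooth φ t - -sawtooth φ x) * (t - x)| := le_abs_self _
        _ = |sawtooth φ t - sawtooth φ x| * |t - x| := by
            rw [abs_mul, ← abs_neg]; congr 2; ring
        _ ≤ Real.pi / (4 * r) * |t - x| * |t - x| := by gcongr
        _ = _ := by rw [mul_assoc, ← sq, sq_abs])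
  have e4 : 2 * r * (Real.pi / (4 * r)) = Real.pi / 2 := by field_simp; norm_num
  simp only [neg_mul] at hloc
  rw [e4, integral_neg] at hloc
  rw [norm_exp_I_mul_analyticExtension (integrable_sawtooth_div hφ) x hy]
  set J := ∫ t, sawtooth φ t * ((x - t) / ((x - t) ^ 2 + y ^ 2) + t / (t ^ 2 + 1)) with hJ
  set w := |x| + y with hw
  have hw0 : 0 < w := by positivity
  have hwr : w ≤ r := by linarith
  have p1 : (2 * w + 2 * r + w) / r ≤ 5 := by rw [div_le_iff₀ hr0]; linarith
  have p2 : (2 * w + 2 * r) / r ≤ 4 := by rw [div_le_iff₀ hr0]; linarith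
  have hJle : 1 / Real.pi * J ≤ 5 / 2 + (Real.log 5 + Real.log 4) := by
    have h1 := (abs_le.mp hmain).2
    have l1 := Real.log_le_log (by positivity) p1
    have l2 := Real.log_le_log (by positivity) p2
    rw [one_div, inv_mul_le_iff₀ hπ]
    nlinarith
  have hE : Real.exp (1 / Real.pi * J) ≤ 260 := by
    refine (Real.exp_le_exp.mpr hJle).trans ?_
    rw [Real.exp_add, Real.exp_add, Real.exp_log (by norm_num), Real.exp_log (by norm_num)]
    have := exp_five_halves_le
    linarith
  rw [Real.exp_neg, one_div]
  exact inv_anti₀ (Real.exp_pos _) hE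

end

/-! ### The damping factor of small exponential type -/

noncomputable section

/-- The Fourier–Laplace transform `(exp(2πi a z) - 1)/(2πi a z)` of the uniform density on
`[0, a]`. -/
def uniformLaplace (a : ℝ) (z : ℂ) : ℂ :=
  (Complex.exp (2 * Real.pi * a * z * Complex.I) - 1) / (2 * Real.pi * a * z * Complex.I)

end

section

variable {a : ℝ}

theorem norm_exp_sub_one_le_norm {w : ℂ} (hw : w.re ≤ 0) : ‖Complex.exp w - 1‖ ≤ ‖w‖ := by
  have h := Convex.norm_image_sub_le_of_norm_deriv_le (f := Complex.exp) (C := 1)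
    (s := {c : ℂ | c.re ≤ 0}) (x := 0) (y := w)
    (fun _ _ => Complex.differentiable_exp _) (fun c hc => by
      rw [Complex.deriv_exp, Complex.norm_exp]
      exact Real.exp_le_one_iff.mpr hc) (convex_halfSpace_re_le 0) (by simp) hw
  simpa using h

theorem re_uniformLaplace_arg_le (ha : 0 < a) {z : ℂ} (hz : 0 ≤ z.im) :
    (2 * Real.pi * a * z * Complex.I).re ≤ 0 := by
  have e : (2 * Real.pi * a * z * Complex.I).re = -(2 * Real.pi * a * z.im) := by
    rw [show (2 * Real.pi * a * z * Complex.I : ℂ) = ((2 * Real.pi * a : ℝ) : ℂ) * (z * Complex.I) by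
      push_cast; ring, Complex.re_ofReal_mul]
    simp
  rw [e]
  have := Real.pi_pos
  have : 0 ≤ 2 * Real.pi * a * z.im := by positivity
  linarith

theorem norm_uniformLaplace_arg (ha : 0 < a) (z : ℂ) :
    ‖(2 * Real.pi * a * z * Complex.I : ℂ)‖ = 2 * Real.pi * a * ‖z‖ := by
  have := Real.pi_pos
  simp [abs_of_pos this, abs_of_pos ha]

theorem norm_uniformLaplace_le_one (ha : 0 < a) {z : ℂ} (hz : 0 ≤ z.im) :
    ‖uniformLaplace a z‖ ≤ 1 := by
  unfold uniformLaplace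
  rw [norm_div]
  exact div_le_one_of_le₀ (norm_exp_sub_one_le_norm (re_uniformLaplace_arg_le ha hz))
    (norm_nonneg _)

theorem norm_uniformLaplace_le (ha : 0 < a) {z : ℂ} (hz : 0 ≤ z.im) (hz0 : z ≠ 0) :
    ‖uniformLaplace a z‖ ≤ 1 / (Real.pi * a * ‖z‖) := by
  have hπ := Real.pi_pos
  have hn := norm_pos_iff.mpr hz0
  unfold uniformLaplace
  rw [norm_div, norm_uniformLaplace_arg ha]
  have h1 : ‖Complex.exp (2 * Real.pi * a * z * Complex.I) - 1‖ ≤ 2 := by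
    refine (norm_sub_le _ _).trans ?_
    rw [norm_one, Complex.norm_exp]
    have := Real.exp_le_one_iff.mpr (re_uniformLaplace_arg_le ha hz)
    linarith
  calc _ ≤ 2 / (2 * Real.pi * a * ‖z‖) := by gcongr
    _ = _ := by field_simp

/-- With w the exponent, |exp w - 1 - w| ≤ |w|² ≤ |w|/2 as soon as |w| ≤ 1/2. -/
theorem half_le_norm_uniformLaplace (ha : 0 < a) {z : ℂ} (hz0 : z ≠ 0)
    (hz : 2 * Real.pi * a * ‖z‖ ≤ 1 / 2) : 1 / 2 ≤ ‖uniformLaplace a z‖ := by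
  have hπ := Real.pi_pos
  have hn := norm_pos_iff.mpr hz0
  have hw := norm_uniformLaplace_arg ha z
  unfold uniformLaplace
  rw [norm_div, le_div_iff₀ (by rw [hw]; positivity)]
  set w : ℂ := 2 * Real.pi * a * z * Complex.I
  have h1 := Complex.norm_exp_sub_one_sub_id_le (x := w) (by rw [hw]; linarith)
  have h2 := norm_sub_norm_le w (w - (Complex.exp w - 1))
  rw [sub_sub_cancel, ← norm_neg (w - (Complex.exp w - 1)), neg_sub] at h2
  rw [← hw] at hz
  nlinarith [norm_nonneg w]

theorem differentiableOn_uniformLaplace (ha : 0 < a) :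
    DifferentiableOn ℂ (uniformLaplace a) {z | 0 < z.im} := by
  unfold uniformLaplace
  refine DifferentiableOn.div (by fun_prop) (by fun_prop) fun z hz => ?_
  have hz0 : z ≠ 0 := by rintro rfl; simp at hz
  have := Real.pi_pos
  rw [← norm_pos_iff, norm_uniformLaplace_arg ha]
  have := norm_pos_iff.mpr hz0
  positivity

theorem tendsto_uniformLaplace (ha : 0 < a) {x : ℝ} (hx : x ≠ 0) :
    Tendsto (fun y : ℝ => uniformLaplace a (x + y * Complex.I)) (𝓝[>] 0)
      (𝓝 (uniformLaplace a x)) := by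
  have hc : ContinuousAt (uniformLaplace a) x := by
    unfold uniformLaplace
    refine ContinuousAt.div (by fun_prop) (by fun_prop) ?_
    have := Real.pi_pos
    rw [← norm_pos_iff, norm_uniformLaplace_arg ha]
    have : 0 < ‖(x : ℂ)‖ := by simpa using hx
    positivity
  have h2 : Tendsto (fun y : ℝ => (x : ℂ) + y * Complex.I) (𝓝 0) (𝓝 (x + (0 : ℝ) * Complex.I)) :=
    Continuous.tendsto (by fun_prop) 0
  simp only [Complex.ofReal_zero, zero_mul, add_zero] at h2
  exact hc.tendsto.comp (h2.mono_left nhdsWithin_le_nhds)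

/-- On the real line `uniformLaplace a` has argument `πax` modulo `π`. -/
theorem uniformLaplace_ofReal (a x : ℝ) :
    uniformLaplace a x = Complex.exp ((Real.pi * a * x : ℝ) * Complex.I)
      * ((Real.sin (Real.pi * a * x) / (Real.pi * a * x) : ℝ) : ℂ) := by
  unfold uniformLaplace
  have e : (2 * Real.pi * a * x * Complex.I : ℂ) = 2 * ((Real.pi * a * x : ℝ) * Complex.I) := by
    push_cast; ring
  rw [e]
  set v : ℝ := Real.pi * a * x with hv
  have h1 : Complex.exp (2 * (v * Complex.I)) - 1
      = Complex.exp (v * Complex.I) * (2 * Complex.I * Complex.sin v) := by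
    have hs : 2 * Complex.I * Complex.sin v
        = Complex.exp (v * Complex.I) - Complex.exp (-(v * Complex.I)) := by
      rw [Complex.sin]
      rw [neg_mul]
      linear_combination (Complex.exp (-(v * Complex.I)) - Complex.exp (v * Complex.I))
        * Complex.I_sq
    rw [hs, mul_sub, ← Complex.exp_add, ← Complex.exp_add, add_neg_cancel, Complex.exp_zero]
    ring_nf
  rw [h1]
  push_cast
  -- At v = 0 both quotients take the default value 0 of division by zero, not the limit 1; the
  -- single point x = 0 is discarded when boundary limits are taken.
  rcases eq_or_ne (v : ℂ) 0 with h | h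
  · simp [h]
  · field_simp

end

/-! ### The multiplier: size, boundary values and phase -/

theorem tendsto_analyticExtension {f : ℝ → ℝ} (hf : Integrable fun t => f t / (1 + t ^ 2))
    {h : ℝ → ℝ} (hh : IsModifiedHilbertTransform f h) :
    ∀ᵐ x : ℝ, Tendsto (fun y : ℝ => analyticExtension f (x + y * Complex.I)) (𝓝[>] 0)
      (𝓝 ((f x : ℂ) + h x * Complex.I)) := by
  filter_upwards [ae_tendsto_integral_abs_sub_mul_poissonKernel hf, hh] with x hx hl
  have h1 := (Complex.continuous_ofReal.tendsto _).comp (tendsto_poissonIntegral hf hx)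
  have h2 := (Complex.continuous_ofReal.tendsto _).comp (tendsto_conjPoissonIntegral hf hx hl)
  refine (h1.add (h2.mul_const Complex.I)).congr' ?_
  filter_upwards [self_mem_nhdsWithin] with y hy
  exact (analyticExtension_add_mul_I hf x hy).symm

theorem norm_exp_neg_analyticExtension_le_one {f : ℝ → ℝ}
    (hf : Integrable fun t => f t / (1 + t ^ 2)) (h0 : ∀ t, 0 ≤ f t) (x : ℝ) {y : ℝ} (hy : 0 < y) :
    ‖Complex.exp (-analyticExtension f (x + y * Complex.I))‖ ≤ 1 := by
  rw [Complex.norm_exp, Real.exp_le_one_iff, analyticExtension_add_mul_I hf x hy]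
  have : 0 ≤ ∫ t, f t * (y / ((x - t) ^ 2 + y ^ 2)) :=
    integral_nonneg fun t => mul_nonneg (h0 t) (by positivity)
  have hπ := Real.pi_pos
  have : 0 ≤ 1 / Real.pi * ∫ t, f t * (y / ((x - t) ^ 2 + y ^ 2)) := by positivity
  simp only [Complex.neg_re, Complex.add_re, Complex.ofReal_re, Complex.re_ofReal_mul,
    Complex.I_re, mul_zero, add_zero]
  linarith

noncomputable section

/-- The multiplier: an outer function times the exponential of a sawtooth's analytic extension,
damped by a fourth power of a bounded function of small exponential type. -/
def multiplier (Ω φ : ℝ → ℝ) (σ : ℝ) (z : ℂ) : ℂ :=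
  Complex.exp (-analyticExtension Ω z) *
    (Complex.exp (Complex.I * analyticExtension (sawtooth φ) z) * uniformLaplace (σ / 8) z ^ 4 / 40664)

/-- The boundary value of `multiplier Ω φ σ`, in terms of the Hilbert transforms `h` of `Ω` and `k`
of `sawtooth φ`. -/
def multiplierBoundary (Ω φ h k : ℝ → ℝ) (σ x : ℝ) : ℂ :=
  Complex.exp (-((Ω x : ℂ) + h x * Complex.I)) *
    (Complex.exp (Complex.I * ((sawtooth φ x : ℂ) + k x * Complex.I))
      * uniformLaplace (σ / 8) x ^ 4 / 40664)

end

section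

variable {Ω φ h k : ℝ → ℝ} {σ : ℝ}

theorem differentiableOn_multiplier (hΩ : Integrable fun t => Ω t / (1 + t ^ 2)) (hφ : Monotone φ)
    (hσ : 0 < σ) : DifferentiableOn ℂ (multiplier Ω φ σ) {z | 0 < z.im} := by
  have h1 : DifferentiableOn ℂ (analyticExtension Ω) {z | 0 < z.im} := fun z hz =>
    (hasDerivAt_analyticExtension hΩ hz).differentiableAt.differentiableWithinAt
  have h2 : DifferentiableOn ℂ (analyticExtension (sawtooth φ)) {z | 0 < z.im} := fun z hz =>
    (hasDerivAt_analyticExtension (integrable_sawtooth_div hφ)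
      hz).differentiableAt.differentiableWithinAt
  have h3 := differentiableOn_uniformLaplace (a := σ / 8) (by positivity)
  unfold multiplier
  exact h1.neg.cexp.mul ((((h2.const_mul _).cexp).mul (h3.pow 4)).div_const _)

theorem tendsto_multiplier (hΩ : Integrable fun t => Ω t / (1 + t ^ 2))
    (hh : IsModifiedHilbertTransform Ω h) (hφ : Monotone φ)
    (hk : IsModifiedHilbertTransform (sawtooth φ) k) (hσ : 0 < σ) :
    ∀ᵐ x : ℝ, Tendsto (fun y : ℝ => multiplier Ω φ σ (x + y * Complex.I)) (𝓝[>] 0)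
      (𝓝 (multiplierBoundary Ω φ h k σ x)) := by
  filter_upwards [tendsto_analyticExtension hΩ hh,
    tendsto_analyticExtension (integrable_sawtooth_div hφ) hk, Measure.ae_ne volume (0 : ℝ)]
    with x h1 h2 hx
  have h3 := tendsto_uniformLaplace (a := σ / 8) (by positivity) hx
  unfold multiplier multiplierBoundary
  exact h1.neg.cexp.mul ((((h2.const_mul _).cexp).mul (h3.pow 4)).div_const _)

theorem norm_multiplier_eq (Ω φ : ℝ → ℝ) (σ : ℝ) (z : ℂ) :
    ‖multiplier Ω φ σ z‖ = ‖Complex.exp (-analyticExtension Ω z)‖ *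
      (‖Complex.exp (Complex.I * analyticExtension (sawtooth φ) z)‖
        * ‖uniformLaplace (σ / 8) z‖ ^ 4 / 40664) := by
  unfold multiplier
  simp

/-- With r = 1/(4σ) the quadratic growth is in the variable v = 4σ(|x|+y) ≤ 8σ|z|, and the damping
factor b satisfies b ≤ 1 and bv ≤ 64/π ≤ 22. The bound 13·68·46 = 40664 is the normalising constant
of `multiplier`. -/
theorem norm_exp_sawtooth_mul_sq_le (hφ : Monotone φ) (hσ : 0 < σ) (hσ1 : σ < 1 / 10) (h0 : φ 0 = 0)
    (hL : ∀ a b, |φ a - φ b| ≤ Real.pi * σ * |a - b|) (x : ℝ) {y : ℝ} (hy : 0 < y) :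
    ‖Complex.exp (Complex.I * analyticExtension (sawtooth φ) (x + y * Complex.I))‖
      * ‖uniformLaplace (σ / 8) (x + y * Complex.I)‖ ^ 2 ≤ 40664 := by
  have hπ := Real.pi_gt_three
  have hr : 1 ≤ 1 / (4 * σ) := by rw [le_div_iff₀ (by positivity)]; linarith
  have hL' : ∀ a b, |φ a - φ b| ≤ Real.pi / (4 * (1 / (4 * σ))) * |a - b| := by
    intro a b
    convert hL a b using 2
    field_simp
  have h1 := norm_exp_sawtooth_le hφ hr h0 hL' x hy
  set z : ℂ := x + y * Complex.I with hz
  have hzim : 0 < z.im := by simpa [hz] using hy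
  have hz0 : z ≠ 0 := by rintro h; rw [h] at hzim; simp at hzim
  have hn := norm_pos_iff.mpr hz0
  have hw : |x| + y ≤ 2 * ‖z‖ := by
    have a1 := Complex.abs_re_le_norm z
    have a2 := Complex.abs_im_le_norm z
    simp only [hz, Complex.add_re, Complex.ofReal_re, Complex.re_ofReal_mul, Complex.I_re, mul_zero,
      add_zero, Complex.add_im, Complex.ofReal_im, Complex.im_ofReal_mul, Complex.I_im, mul_one,
      zero_add, abs_of_pos hy] at a1 a2
    rw [← hz] at a1 a2
    linarith
  set b := ‖uniformLaplace (σ / 8) z‖ with hb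
  have hb0 : 0 ≤ b := norm_nonneg _
  have hb1 : b ≤ 1 := norm_uniformLaplace_le_one (by positivity) hzim.le
  have hb2 : b ≤ 1 / (Real.pi * (σ / 8) * ‖z‖) :=
    norm_uniformLaplace_le (by positivity) hzim.le hz0
  set v := (|x| + y) / (1 / (4 * σ)) with hv
  have hv0 : 0 ≤ v := by positivity
  have hvle : v ≤ 8 * σ * ‖z‖ := by
    rw [hv, div_div_eq_mul_div, div_one]
    nlinarith
  have hbv : b * v ≤ 22 := by
    calc b * v ≤ 1 / (Real.pi * (σ / 8) * ‖z‖) * (8 * σ * ‖z‖) := by gcongr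
      _ = 64 / Real.pi := by field_simp; norm_num
      _ ≤ 22 := by rw [div_le_iff₀ (by linarith)]; linarith
  calc _ ≤ 13 * ((2 + 3 * v) * (2 + 2 * v)) * b ^ 2 := by gcongr
    _ = 13 * ((2 * b + 3 * (b * v)) * (2 * b + 2 * (b * v))) := by ring
    _ ≤ 13 * ((2 * 1 + 3 * 22) * (2 * 1 + 2 * 22)) := by gcongr
    _ = 40664 := by norm_num

/-- Two of the four damping factors are spent on the growth of the sawtooth factor; the two that
remain provide the quadratic decay that Paley–Wiener needs. -/
theorem norm_multiplier_le_outer (hφ : Monotone φ) (hσ : 0 < σ) (hσ1 : σ < 1 / 10) (h0 : φ 0 = 0)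
    (hL : ∀ a b, |φ a - φ b| ≤ Real.pi * σ * |a - b|) (x : ℝ) {y : ℝ} (hy : 0 < y) :
    ‖multiplier Ω φ σ (x + y * Complex.I)‖
      ≤ ‖Complex.exp (-analyticExtension Ω (x + y * Complex.I))‖
        * ‖uniformLaplace (σ / 8) (x + y * Complex.I)‖ ^ 2 := by
  have h1 := norm_exp_sawtooth_mul_sq_le hφ hσ hσ1 h0 hL x hy
  rw [norm_multiplier_eq]
  gcongr
  rw [div_le_iff₀ (by norm_num)]
  nlinarith [sq_nonneg ‖uniformLaplace (σ / 8) (x + y * Complex.I)‖]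

theorem norm_multiplier_le (hΩ : Integrable fun t => Ω t / (1 + t ^ 2)) (hΩ0 : ∀ t, 0 ≤ Ω t)
    (hφ : Monotone φ) (hσ : 0 < σ) (hσ1 : σ < 1 / 10) (h0 : φ 0 = 0)
    (hL : ∀ a b, |φ a - φ b| ≤ Real.pi * σ * |a - b|) {z : ℂ} (hz : 0 < z.im) :
    ‖multiplier Ω φ σ z‖ ≤ (1 + (1 / (Real.pi * (σ / 8))) ^ 2) / (1 + ‖z‖ ^ 2) := by
  have hπ := Real.pi_pos
  have hz0 : z ≠ 0 := by rintro rfl; simp at hz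
  have hn := norm_pos_iff.mpr hz0
  have h1 := norm_multiplier_le_outer (Ω := Ω) hφ hσ hσ1 h0 hL z.re hz
  have h2 := norm_exp_neg_analyticExtension_le_one hΩ hΩ0 z.re hz
  rw [Complex.re_add_im] at h1 h2
  have hb1 : ‖uniformLaplace (σ / 8) z‖ ≤ 1 := norm_uniformLaplace_le_one (by positivity) hz.le
  have hb2 : ‖uniformLaplace (σ / 8) z‖ * ‖z‖ ≤ 1 / (Real.pi * (σ / 8)) := by
    refine (mul_le_mul_of_nonneg_right
      (norm_uniformLaplace_le (by positivity) hz.le hz0) hn.le).trans (le_of_eq ?_)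
    field_simp
  rw [le_div_iff₀ (by positivity)]
  calc _ ≤ 1 * ‖uniformLaplace (σ / 8) z‖ ^ 2 * (1 + ‖z‖ ^ 2) := by
        gcongr; exact h1.trans (by gcongr)
    _ = ‖uniformLaplace (σ / 8) z‖ ^ 2 + (‖uniformLaplace (σ / 8) z‖ * ‖z‖) ^ 2 := by ring
    _ ≤ 1 ^ 2 + (1 / (Real.pi * (σ / 8))) ^ 2 := by gcongr
    _ = _ := by ring

/-- The sawtooth factor is at least 1/260, each of the four damping factors at least 1/2 because |z|
≤ 2 and σ is small, and 40664 is the normalisation. -/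
theorem le_norm_multiplier (hφ : Monotone φ) (hσ : 0 < σ) (hσ1 : σ < 1 / 10) (h0 : φ 0 = 0)
    (hL : ∀ a b, |φ a - φ b| ≤ Real.pi * σ * |a - b|) {x y : ℝ} (hx : |x| ≤ 1) (hy : 0 < y)
    (hy1 : y ≤ 1) :
    1 / (260 * 16 * 40664) * ‖Complex.exp (-analyticExtension Ω (x + y * Complex.I))‖
      ≤ ‖multiplier Ω φ σ (x + y * Complex.I)‖ := by
  have hπ := Real.pi_lt_four
  have hπ0 := Real.pi_pos
  have hr : 2 ≤ 1 / (4 * σ) := by rw [le_div_iff₀ (by positivity)]; linarith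
  have hL' : ∀ a b, |φ a - φ b| ≤ Real.pi / (4 * (1 / (4 * σ))) * |a - b| := by
    intro a b
    convert hL a b using 2
    field_simp
  have h1 := le_norm_exp_sawtooth hφ hr h0 hL' hx hy hy1
  rw [norm_multiplier_eq]
  set z : ℂ := x + y * Complex.I with hz
  have hzim : 0 < z.im := by simpa [hz] using hy
  have hz0 : z ≠ 0 := by rintro h; rw [h] at hzim; simp at hzim
  have hn : ‖z‖ ≤ 2 := by
    refine (norm_add_le _ _).trans ?_
    simp only [Complex.norm_real, norm_mul, Complex.norm_I, mul_one, Real.norm_eq_abs,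
      abs_of_pos hy]
    linarith
  have h2 : 1 / 2 ≤ ‖uniformLaplace (σ / 8) z‖ := by
    apply half_le_norm_uniformLaplace (by positivity) hz0
    calc 2 * Real.pi * (σ / 8) * ‖z‖ ≤ 2 * 4 * ((1 / 10) / 8) * 2 := by gcongr
      _ ≤ 1 / 2 := by norm_num
  rw [mul_comm]
  refine mul_le_mul_of_nonneg_left ?_ (norm_nonneg _)
  calc (1 : ℝ) / (260 * 16 * 40664) = 1 / 260 * (1 / 2) ^ 4 / 40664 := by norm_num
    _ ≤ _ := by gcongr

theorem norm_multiplierBoundary_bounds (hΩ : Integrable fun t => Ω t / (1 + t ^ 2))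
    (hh : IsModifiedHilbertTransform Ω h) (hφ : Monotone φ)
    (hk : IsModifiedHilbertTransform (sawtooth φ) k) (hσ : 0 < σ) (hσ1 : σ < 1 / 10) (h0 : φ 0 = 0)
    (hL : ∀ a b, |φ a - φ b| ≤ Real.pi * σ * |a - b|) :
    ∀ᵐ x : ℝ, ‖multiplierBoundary Ω φ h k σ x‖ ≤ Real.exp (-Ω x) ∧
      (|x| ≤ 1 → 1 / (260 * 16 * 40664) * Real.exp (-Ω x) ≤ ‖multiplierBoundary Ω φ h k σ x‖) := by
  filter_upwards [tendsto_multiplier hΩ hh hφ hk hσ, tendsto_analyticExtension hΩ hh] with x h1 h2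
  have h3 : Tendsto (fun y : ℝ => ‖Complex.exp (-analyticExtension Ω (x + y * Complex.I))‖) (𝓝[>] 0)
      (𝓝 (Real.exp (-Ω x))) := by
    have h4 := h2.neg.cexp.norm
    rw [Complex.norm_exp] at h4
    convert h4 using 3
    simp
  refine ⟨le_of_tendsto_of_tendsto h1.norm h3 ?_, fun hx =>
    le_of_tendsto_of_tendsto (h3.const_mul _) h1.norm ?_⟩
  · filter_upwards [self_mem_nhdsWithin] with y hy
    refine (norm_multiplier_le_outer hφ hσ hσ1 h0 hL x hy).trans
      (mul_le_of_le_one_right (norm_nonneg _) (pow_le_one₀ (norm_nonneg _) ?_))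
    exact norm_uniformLaplace_le_one (by positivity) (by simpa using le_of_lt hy)
  · filter_upwards [Ioo_mem_nhdsGT one_pos] with y hy
    exact le_norm_multiplier hφ hσ hσ1 h0 hL hx hy.1 hy.2.le

/-- The phases add up: -h from the outer factor, πσx/2 + h - c - πN from the sawtooth, and 4·πσx/8
from the damping. The total is θ = πσx - c - πN, and πN disappears on passing to 2θ modulo 2π. -/
theorem conj_multiplierBoundary {c x : ℝ} (hφx : φ x = Real.pi * σ / 2 * x + h x - c) :
    (starRingEnd ℂ) (multiplierBoundary Ω φ h k σ x) = Complex.exp (2 * c * Complex.I)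
      * Complex.exp (-(2 * Real.pi * σ * x) * Complex.I) * multiplierBoundary Ω φ h k σ x := by
  set N : ℤ := ⌊φ x / Real.pi + 1 / 2⌋ with hN
  set θ : ℝ := Real.pi * σ * x - c - Real.pi * N with hθ
  set q : ℝ := Real.sin (Real.pi * (σ / 8) * x) / (Real.pi * (σ / 8) * x) with hq
  set ρ : ℝ := Real.exp (-Ω x) * Real.exp (-k x) * q ^ 4 / 40664 with hρ
  have e : multiplierBoundary Ω φ h k σ x = ρ * Complex.exp (θ * Complex.I) := by
    have hs : sawtooth φ x = Real.pi * σ / 2 * x + h x - c - Real.pi * N := by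
      unfold sawtooth; rw [← hN, hφx]
    have e1 : Complex.exp (θ * Complex.I) =
        Complex.exp (-(h x * Complex.I)) * Complex.exp (Complex.I * sawtooth φ x)
        * Complex.exp ((Real.pi * (σ / 8) * x : ℝ) * Complex.I) ^ 4 := by
      rw [← Complex.exp_nat_mul, ← Complex.exp_add, ← Complex.exp_add]
      congr 1
      rw [hs, hθ]; push_cast; ring
    have e2 : Complex.exp (-((Ω x : ℂ) + h x * Complex.I))
        = (Real.exp (-Ω x) : ℝ) * Complex.exp (-(h x * Complex.I)) := by
      rw [Complex.ofReal_exp, ← Complex.exp_add]; congr 1; push_cast; ring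
    have e3 : Complex.exp (Complex.I * ((sawtooth φ x : ℂ) + k x * Complex.I))
        = (Real.exp (-k x) : ℝ) * Complex.exp (Complex.I * sawtooth φ x) := by
      rw [Complex.ofReal_exp, ← Complex.exp_add]; congr 1; push_cast
      linear_combination (k x : ℂ) * Complex.I_sq
    unfold multiplierBoundary
    rw [uniformLaplace_ofReal, e1, e2, e3, hρ, ← hq]
    push_cast
    ring
  have e4 : Complex.exp (-(θ * Complex.I)) = Complex.exp (2 * c * Complex.I)
      * Complex.exp (-(2 * Real.pi * σ * x) * Complex.I) * Complex.exp (θ * Complex.I) := by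
    rw [← Complex.exp_add, ← Complex.exp_add, Complex.exp_eq_exp_iff_exists_int]
    refine ⟨N, ?_⟩
    rw [hθ]; push_cast; ring
  rw [e, map_mul, Complex.conj_ofReal, ← Complex.exp_conj, map_mul, Complex.conj_ofReal,
    Complex.conj_I, mul_neg, e4]
  ring

end

/-! ### Assembling the theorem -/

theorem ofReal_mul_eLpNorm_le {κ : ℝ} (hκ : 0 ≤ κ) {ω : ℝ → ℝ} (hω : ∀ x, 0 ≤ ω x) {g : ℝ → ℂ}
    {s t : Set ℝ} (hst : s ⊆ t) (hs : MeasurableSet s) (h : ∀ᵐ x, x ∈ s → κ * ω x ≤ ‖g x‖) :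
    ENNReal.ofReal κ * eLpNorm ω 2 (volume.restrict s) ≤ eLpNorm g 2 (volume.restrict t) := by
  calc ENNReal.ofReal κ * eLpNorm ω 2 (volume.restrict s)
      = eLpNorm (κ • ω) 2 (volume.restrict s) := by
        rw [eLpNorm_const_smul, Real.enorm_eq_ofReal hκ]
    _ ≤ eLpNorm g 2 (volume.restrict s) := by
        apply eLpNorm_mono_ae
        rw [ae_restrict_iff' hs]
        filter_upwards [h] with x hx hxs
        rw [Pi.smul_apply, smul_eq_mul, Real.norm_of_nonneg (mul_nonneg hκ (hω x))]
        exact hx hxs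
    _ ≤ _ := eLpNorm_mono_measure _ (Measure.restrict_mono hst le_rfl)

theorem theoremt (ω : ℝ → ℝ) (σ : ℝ)
    (hω : ∀ x, 0 < ω x ∧ ω x ≤ 1)
    (hlog : Integrable (fun x : ℝ => Real.log (ω x) / (1 + x ^ 2)))
    (hσ : 0 < σ ∧ σ < 1 / 10)
    (h u : ℝ → ℝ)
    (hh : IsModifiedHilbertTransform (fun x => -Real.log (ω x)) h)
    (hu : HasWeakDeriv h u)
    (hbound : eLpNorm u ∞ volume ≤ ENNReal.ofReal (Real.pi / 2 * σ)) :
    ∃ ψ : Lp ℂ 2 (volume : Measure ℝ),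
      (∀ᵐ x : ℝ, x ∉ Set.Icc (0 : ℝ) σ → ψ x = 0) ∧
      (∀ᵐ ξ : ℝ, ‖(𝓕 ψ : Lp ℂ 2 (volume : Measure ℝ)) ξ‖ ≤ ω ξ) ∧
      ENNReal.ofReal (σ ^ 6 / 600000) *
          min (eLpNorm ω 2 (volume.restrict (Set.Ioo (1 / 2 : ℝ) 1)))
            (eLpNorm ω 2 (volume.restrict (Set.Ioo (-1 : ℝ) (-(1 / 2)))))
        ≤ eLpNorm (𝓕 ψ : Lp ℂ 2 (volume : Measure ℝ)) 2
            (volume.restrict (Set.Icc (-1 : ℝ) 1)) := by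
  obtain ⟨hσ0, hσ1⟩ := hσ
  have hπ := Real.pi_pos
  set Ω : ℝ → ℝ := fun x => -Real.log (ω x) with hΩdef
  have hΩ : Integrable fun t => Ω t / (1 + t ^ 2) := by
    simpa [hΩdef, neg_div] using hlog.neg
  have hΩ0 : ∀ t, 0 ≤ Ω t := fun t => by
    simpa [hΩdef] using Real.log_nonpos (hω t).1.le (hω t).2
  have hΩexp : ∀ t, Real.exp (-Ω t) = ω t := fun t => by
    simp [hΩdef, Real.exp_log (hω t).1]
  have huB : ∀ᵐ x, |u x| ≤ Real.pi / 2 * σ := by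
    rw [eLpNorm_exponent_top] at hbound
    filter_upwards [ae_le_eLpNormEssSup (f := u) (μ := volume)] with x hx
    have := hx.trans hbound
    rwa [Real.enorm_eq_ofReal_abs, ENNReal.ofReal_le_ofReal_iff (by positivity)] at this
  obtain ⟨k₀, hk₀, hk₀L⟩ := hu.exists_lipschitz huB
  -- The linear term has slope πσ/2, the Lipschitz constant of `k₀`, so φ is increasing with slopes
  -- between 0 and πσ. Subtracting `k₀ 0` gives φ(0) = 0.
  set φ : ℝ → ℝ := fun x => Real.pi * σ / 2 * x + k₀ x - k₀ 0 with hφdef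
  have hφ : Monotone φ := by
    intro a b hab
    have := (abs_le.mp (hk₀L b a)).1
    rw [abs_of_nonneg (sub_nonneg.mpr hab)] at this
    simp only [hφdef]
    nlinarith
  have hφ0 : φ 0 = 0 := by simp [hφdef]
  have hφL : ∀ a b, |φ a - φ b| ≤ Real.pi * σ * |a - b| := by
    intro a b
    have e : φ a - φ b = Real.pi * σ / 2 * (a - b) + (k₀ a - k₀ b) := by
      simp only [hφdef]; ring
    rw [e]
    refine (abs_add_le _ _).trans ?_
    rw [abs_mul, abs_of_pos (by positivity : 0 < Real.pi * σ / 2)]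
    linarith [hk₀L a b]
  obtain ⟨k, hk⟩ := exists_isModifiedHilbertTransform_sawtooth hφ hφL
  obtain ⟨ψ, hψ1, hψ2⟩ := exists_fourier_eq_conj (F := multiplier Ω φ σ) (σ := σ)
    (F₀ := multiplierBoundary Ω φ h k σ) (c := Complex.exp (2 * k₀ 0 * Complex.I))
    (differentiableOn_multiplier hΩ hφ hσ0)
    (fun z hz => norm_multiplier_le hΩ hΩ0 hφ hσ0 hσ1 hφ0 hφL hz)
    (tendsto_multiplier hΩ hh hφ hk hσ0) (by
      filter_upwards [hk₀] with x hx
      exact conj_multiplierBoundary (by rw [hx]))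
  have hbd := norm_multiplierBoundary_bounds hΩ hh hφ hk hσ0 hσ1 hφ0 hφL
  -- The construction yields an absolute constant in place of a power of σ; the stated one is
  -- smaller since σ < 1/10.
  have hκ : σ ^ 6 / 600000 ≤ 1 / (260 * 16 * 40664) := by
    have : σ ^ 6 ≤ (1 / 10) ^ 6 := by gcongr
    calc σ ^ 6 / 600000 ≤ (1 / 10) ^ 6 / 600000 := by gcongr
      _ ≤ _ := by norm_num
  refine ⟨ψ, hψ1, ?_, ?_⟩
  · filter_upwards [hψ2, hbd] with x h1 h2
    rw [h1, RCLike.norm_conj, ← hΩexp]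
    exact h2.1
  -- The pointwise lower bound holds on all of [-1, 1], so the interval (1/2, 1) alone suffices.
  · refine le_trans (mul_le_mul_right (min_le_left _ _) _) ?_
    refine ofReal_mul_eLpNorm_le (by positivity) (fun x => (hω x).1.le)
      (fun x hx => ⟨by linarith [hx.1], hx.2.le⟩) measurableSet_Ioo ?_
    filter_upwards [hψ2, hbd] with x h1 h2 hx
    rw [h1, RCLike.norm_conj]
    refine le_trans ?_ (h2.2 (by rw [abs_of_pos (by linarith [hx.1])]; exact hx.2.le))
    rw [hΩexp]
    exact mul_le_mul_of_nonneg_right hκ (hω x).1.le
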